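/- For $x>0$ let $\lceil x\rceil^{\mathfrak p}$ denote the smallest prime $\ge x$. For a Dirichlet character $\chi$ mod $N$ let $\tau(\chi)=\sum_{b=1}^{N}\chi(b)e^{2\pi i b/N}$ be its Gauss sum, and let $\chi_0$ be the principal character mod $N$. Let $\mathcal D_{\pm}(N)$ be the set of primitive Dirichlet characters $\chi$ mod $N$ with $\chi(-1)=\pm1$, and $\mathcal I_{\pm}(N)$ the set of imprimitive Dirichlet characters $\chi\ne\chi_0$ mod $N$ with $\chi(-1)=\pm1$. For real $c>1$, $y>0$ and $X>0$ put $$Q_{\pm}(y,X,c)=\frac1X\sum_{\substack{N\in[X,cX]\\ N\not\equiv 2\bmod 4}}\ \sum_{\chi\in\mathcal D_{\pm}(N)}\frac{\chi(\lceil yX\rceil^{\mathfrak p})}{\tau(\chi)},\qquad E_{\pm}(y,X,c)=\frac1X\sum_{\substack{N\in[X,cX]\\ N\not\equiv 2\bmod 4}}\frac1N\sum_{\chi\in\mathcal I_{\pm}(N)}\tau(\overline{\chi})\,\chi(\lceil yX\rceil^{\mathfrak p}),$$ where $N$ runs over integers, and $$T_{\pm}(y,X,c)=Q_{\pm}(y,X,c)\pm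 E_{\pm}(y,X,c).$$ Then for all real $c>1$ and $y>0$, as $X\to\infty$ through the real numbers, $$\lim_{X\to\infty}T_{+}(y,X,c)=\frac{5}{\pi^2}\int_1^c\cos\left(\frac{2\pi y}{x}\right)dx,\qquad \lim_{X\to\infty}T_{-}(y,X,c)=-i\,\frac{5}{\pi^2}\int_1^c\sin\left(\frac{2\pi y}{x}\right)dx.$$ -/

import Mathlib

namespace Murmuration

/-- The smallest prime `p` with `x ≤ p`. -/
noncomputable def primeCeil (x : ℝ) : ℕ :=
  sInf {p : ℕ | p.Prime ∧ x ≤ (p : ℝ)}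

/-- The infimum defining `primeCeil` is attained. -/
theorem primeCeil_spec (x : ℝ) : (primeCeil x).Prime ∧ x ≤ (primeCeil x : ℝ) := by
  obtain ⟨p, hp, hpp⟩ := Nat.exists_infinite_primes ⌈x⌉₊
  exact Nat.sInf_mem (s := {p : ℕ | p.Prime ∧ x ≤ (p : ℝ)}) ⟨p, hpp, Nat.ceil_le.mp hp⟩

/-- The Gauss sum `τ(χ) = ∑_{b=1}^N χ(b) e^{2πib/N}` of a Dirichlet character mod `N`. -/
noncomputable def tau {N : ℕ} (χ : DirichletCharacter ℂ N) : ℂ :=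
  ∑ b ∈ Finset.Icc 1 N,
    χ (b : ZMod N) * Complex.exp (2 * Real.pi * Complex.I * (b : ℂ) / (N : ℂ))

/-- For `N ≥ 1`, `tau` is Mathlib's Gauss sum for the standard additive character. -/
theorem tau_eq_gaussSum {N : ℕ} [NeZero N] (χ : DirichletCharacter ℂ N) :
    tau χ = gaussSum χ ZMod.stdAddChar := by
  have hN : 0 < N := Nat.pos_of_ne_zero (NeZero.ne N)
  unfold tau gaussSum
  refine Finset.sum_bij (fun b _ => (b : ZMod N)) (fun _ _ => Finset.mem_univ _) ?_ ?_ ?_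
  · intro a ha b hb h
    rw [Finset.mem_Icc] at ha hb
    have h' : a ≡ b [MOD N] := (ZMod.natCast_eq_natCast_iff a b N).mp h
    rcases lt_or_eq_of_le ha.2 with h1 | h1 <;> rcases lt_or_eq_of_le hb.2 with h2 | h2
    · exact Nat.ModEq.eq_of_lt_of_lt h' h1 h2
    · simp [Nat.ModEq, h2, Nat.mod_eq_of_lt h1] at h'; omega
    · simp [Nat.ModEq, h1, Nat.mod_eq_of_lt h2] at h'; omega
    · omega
  · intro z _
    by_cases hz : z = 0
    · exact ⟨N, Finset.mem_Icc.mpr ⟨hN, le_rfl⟩, by simp [hz]⟩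
    · refine ⟨z.val, Finset.mem_Icc.mpr ⟨?_, (ZMod.val_lt z).le⟩, by simp⟩
      exact Nat.pos_of_ne_zero (fun h => hz ((ZMod.val_eq_zero z).mp h))
  · intro b _
    rw [ZMod.stdAddChar_apply, ZMod.toCircle_natCast]

/-- The primitive Dirichlet characters `χ` mod `N` with `χ(-1) = ε`; here `ε = 1` gives the even
and `ε = -1` the odd ones. -/
noncomputable def primitiveChars (ε : ℤˣ) (N : ℕ) : Finset (DirichletCharacter ℂ N) :=
  open Classical in
  Finset.univ.filter fun χ => χ.IsPrimitive ∧ χ (-1) = ((ε : ℤ) : ℂ)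

/-- The imprimitive non-principal Dirichlet characters `χ` mod `N` with `χ(-1) = ε`. -/
noncomputable def imprimitiveChars (ε : ℤˣ) (N : ℕ) : Finset (DirichletCharacter ℂ N) :=
  open Classical in
  Finset.univ.filter fun χ => ¬ χ.IsPrimitive ∧ χ ≠ 1 ∧ χ (-1) = ((ε : ℤ) : ℂ)

/-- The integers `N ∈ [X, cX]` with `N ≢ 2 mod 4` (for `X > 0`). -/
noncomputable def conductors (X c : ℝ) : Finset ℕ :=
  (Finset.Icc ⌈X⌉₊ ⌊c * X⌋₊).filter fun N => ¬ N ≡ 2 [MOD 4]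

theorem mem_conductors {X c : ℝ} (hX : 0 < X) (hc : 1 < c) (N : ℕ) :
    N ∈ conductors X c ↔ (X ≤ N ∧ (N : ℝ) ≤ c * X) ∧ ¬ N ≡ 2 [MOD 4] := by
  have h : 0 ≤ c * X := by positivity
  simp [conductors, Nat.le_floor_iff h]

/-- `Q_ε(y, X, c)`, the normalized sum of `χ(⌈yX⌉^𝔭) / τ(χ)` over primitive characters. -/
noncomputable def Q (ε : ℤˣ) (y X c : ℝ) : ℂ :=
  1 / (X : ℂ) * ∑ N ∈ conductors X c, ∑ χ ∈ primitiveChars ε N,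
    χ (primeCeil (y * X) : ZMod N) / tau χ

/-- `E_ε(y, X, c)`, the contribution of the imprimitive characters; `star χ` is the complex
conjugate character. -/
noncomputable def E (ε : ℤˣ) (y X c : ℝ) : ℂ :=
  1 / (X : ℂ) * ∑ N ∈ conductors X c, 1 / (N : ℂ) * ∑ χ ∈ imprimitiveChars ε N,
    tau (star χ) * χ (primeCeil (y * X) : ZMod N)

/-- `T_±(y, X, c) = Q_±(y, X, c) ± E_±(y, X, c)`. -/
noncomputable def T (ε : ℤˣ) (y X c : ℝ) : ℂ :=
  Q ε y X c + ((ε : ℤ) : ℂ) * E ε y X c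

end Murmuration

/-!
Write `p` for the prime `⌈yX⌉^𝔭`. For primitive `χ` mod `N` the duality `τ(χ) τ(χ̄) = χ(-1) N` turns
`χ(p) / τ(χ)` into `χ(-1) τ(χ̄) χ(p) / N`. Hence `T_±` is the mean over `N` of
`±N⁻¹ ∑ τ(χ̄) χ(p)`, where `χ` runs over all nonprincipal characters of one parity. Since
`|τ(χ₀)| = |μ(N)| ≤ 1`, the principal character may be put back, and for `p ∤ N` orthogonality
evaluates the sum: `φ(N) / N` times `cos (2πp / N)` or `-i sin (2πp / N)`.

Consecutive primes have ratio tending to `1`, so `p` may be replaced by `yX`. This follows from a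
Tauberian argument: smoothing the logarithmic derivative of `ζ` on the line `Re s = 1` against the
Fejér kernel shows that any window of fixed width on the logarithmic scale eventually contains a
prime.

It remains to average `φ(N) / N` over `N ≢ 2 mod 4`. Splitting `N` by its residue modulo `4` reduces
this to Wintner's theorem for a divisor sum, the mean value is `5 / π²`, and Abel summation against
the smooth wave gives the integral.
-/

namespace Murmuration
open MeasureTheory Filter Topology
open ZMod (stdAddChar)

/-! ### The Fejér kernel -/

theorem sinc_mul_self (u : ℝ) : Real.sinc u * u = Real.sin u := by
  rcases eq_or_ne u 0 with rfl | hu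
  · simp
  · rw [Real.sinc_of_ne_zero hu, div_mul_cancel₀ _ hu]

theorem sinc_sq_le_one (u : ℝ) : Real.sinc u ^ 2 ≤ 1 :=
  (sq_le_one_iff_abs_le_one _).mpr (Real.abs_sinc_le_one u)

theorem integrable_sinc_sq : Integrable fun u : ℝ ↦ Real.sinc u ^ 2 := by
  refine (integrable_inv_one_add_sq.const_mul 2).mono'
    (Real.continuous_sinc.pow 2).aestronglyMeasurable (Eventually.of_forall fun u ↦ ?_)
  rw [Real.norm_of_nonneg (sq_nonneg _), ← div_eq_mul_inv, le_div_iff₀ (by positivity)]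
  calc Real.sinc u ^ 2 * (1 + u ^ 2) = Real.sinc u ^ 2 + Real.sin u ^ 2 := by
        rw [← sinc_mul_self]; ring
    _ ≤ 2 := by linarith [sinc_sq_le_one u, Real.sin_sq_le_one u]

theorem integral_sinc_sq_pos : 0 < ∫ u : ℝ, Real.sinc u ^ 2 :=
  integral_pos_of_integrable_nonneg_nonzero (x := 0) (Real.continuous_sinc.pow 2)
    integrable_sinc_sq (fun _ ↦ sq_nonneg _) (by simp)

theorem integrable_sinc_sq_comp_mul_sub {R : ℝ} (hR : R ≠ 0) (w : ℝ) :
    Integrable fun v ↦ Real.sinc (R * (v - w)) ^ 2 :=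
  (integrable_sinc_sq.comp_mul_left' hR).comp_sub_right w

theorem integral_sinc_sq_comp_mul {R : ℝ} (hR : 0 < R) :
    ∫ v, Real.sinc (R * v) ^ 2 = (∫ u : ℝ, Real.sinc u ^ 2) / R := by
  rw [Measure.integral_comp_mul_left fun u ↦ Real.sinc u ^ 2, abs_of_pos (inv_pos.mpr hR),
    smul_eq_mul, inv_mul_eq_div]

/-- Since `sin² + cos² = 1`, shifting by `π / 2` covers the zeros of `sinc`. -/
theorem sinc_sq_comp_mul_le {δ R u : ℝ} (hδ : 0 < δ) (hR : R ≠ 0) (hu : δ ≤ |u|) :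
    Real.sinc (R * u) ^ 2 ≤ (1 + Real.pi / 2 / δ) ^ 2 / R ^ 2 *
      (Real.sinc u ^ 2 + Real.sinc (u + Real.pi / 2) ^ 2) := by
  have hu0 : u ≠ 0 := abs_pos.mp (hδ.trans_le hu)
  set M := 1 + Real.pi / 2 / δ with hM
  have hM1 : 1 ≤ M := le_add_of_nonneg_right (by positivity)
  have h_shift : (u + Real.pi / 2) ^ 2 ≤ M ^ 2 * u ^ 2 := by
    rw [← mul_pow, sq_le_sq, abs_mul, abs_of_pos (one_pos.trans_le hM1)]
    calc |u + Real.pi / 2| ≤ |u| + Real.pi / 2 := by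
          simpa only [abs_of_pos Real.pi_div_two_pos] using abs_add_le u (Real.pi / 2)
      _ = |u| + Real.pi / 2 / δ * δ := by field_simp
      _ ≤ |u| + Real.pi / 2 / δ * |u| := by gcongr
      _ = M * |u| := by rw [hM]; ring
  have h_one : 1 ≤ M ^ 2 * u ^ 2 * (Real.sinc u ^ 2 + Real.sinc (u + Real.pi / 2) ^ 2) := by
    calc (1 : ℝ) = u ^ 2 * Real.sinc u ^ 2
          + (u + Real.pi / 2) ^ 2 * Real.sinc (u + Real.pi / 2) ^ 2 := by
          rw [← mul_pow, ← mul_pow, mul_comm, sinc_mul_self, mul_comm, sinc_mul_self,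
            Real.sin_add_pi_div_two, Real.sin_sq_add_cos_sq]
      _ ≤ M ^ 2 * u ^ 2 * Real.sinc u ^ 2 + M ^ 2 * u ^ 2 * Real.sinc (u + Real.pi / 2) ^ 2 := by
          gcongr
          exact le_mul_of_one_le_left (sq_nonneg u) (one_le_pow₀ hM1)
      _ = _ := by ring
  calc Real.sinc (R * u) ^ 2 = Real.sin (R * u) ^ 2 / (R ^ 2 * u ^ 2) := by
        rw [Real.sinc_of_ne_zero (mul_ne_zero hR hu0), div_pow, mul_pow]
    _ ≤ M ^ 2 * u ^ 2 * (Real.sinc u ^ 2 + Real.sinc (u + Real.pi / 2) ^ 2) / (R ^ 2 * u ^ 2) := by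
        gcongr
        exact (Real.sin_sq_le_one _).trans h_one
    _ = _ := by field_simp

theorem integral_one_sub_mul_cos (u : ℝ) :
    ∫ t in (0 : ℝ)..1, 2 * (1 - t) * Real.cos (2 * t * u) = Real.sinc u ^ 2 := by
  rcases eq_or_ne u 0 with rfl | hu
  · simp only [mul_zero, Real.cos_zero, mul_one, Real.sinc_zero,
      intervalIntegral.integral_const_mul]
    rw [intervalIntegral.integral_sub (by simp) (by simp), integral_id]
    norm_num
  have hderiv (t : ℝ) : HasDerivAt (fun t : ℝ ↦
      (1 - t) * Real.sin (2 * t * u) / u - Real.cos (2 * t * u) / (2 * u ^ 2))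
      (2 * (1 - t) * Real.cos (2 * t * u)) t := by
    have hlin : HasDerivAt (fun t : ℝ ↦ 2 * t * u) (2 * u) t := by
      simpa using ((hasDerivAt_id t).const_mul 2).mul_const u
    refine (((((hasDerivAt_id t).const_sub 1).mul hlin.sin).div_const u).sub
      (hlin.cos.div_const (2 * u ^ 2))).congr_deriv ?_
    simp only [id_eq]
    field_simp
    ring
  rw [intervalIntegral.integral_eq_sub_of_hasDerivAt (fun t _ ↦ hderiv t)
    (Continuous.intervalIntegrable (by fun_prop) _ _), Real.sinc_of_ne_zero hu]
  simp only [mul_one, sub_self, zero_mul, zero_div, mul_zero, Real.sin_zero, Real.cos_zero]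
  rw [div_pow, Real.sin_sq_eq_half_sub]
  field_simp
  ring

/-- The Fourier transform of `F` weighted by the triangle function `1 - |t|` on `[-1, 1]`. The
frequency is doubled, so that the transform of `1` is exactly `Real.sinc ^ 2`. -/
noncomputable def triangleTransform (F : ℝ → ℂ) (w : ℝ) : ℂ :=
  ∫ t in (-1 : ℝ)..1, ((1 - |t| : ℝ) : ℂ) * Complex.exp (2 * t * w * Complex.I) * F t

theorem triangleTransform_exp (lam w : ℝ) :
    triangleTransform (fun t ↦ Complex.exp (-(2 * t * lam * Complex.I))) w =
      (Real.sinc (lam - w) ^ 2 : ℝ) := by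
  set f : ℝ → ℂ := fun t ↦ ((1 - |t| : ℝ) : ℂ) * Complex.exp (-(2 * t * (lam - w) * Complex.I))
    with hf
  have hfc : Continuous f := by fun_prop
  have h_eq : triangleTransform (fun t ↦ Complex.exp (-(2 * t * lam * Complex.I))) w =
      ∫ t in (-1 : ℝ)..1, f t := by
    refine intervalIntegral.integral_congr fun t _ ↦ ?_
    simp only [hf, mul_assoc ((1 - |t| : ℝ) : ℂ), ← Complex.exp_add]
    ring_nf
  have h_even : ∫ t in (-1 : ℝ)..0, f t = ∫ t in (0 : ℝ)..1, f (-t) := by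
    rw [intervalIntegral.integral_comp_neg, neg_zero]
  rw [h_eq, ← intervalIntegral.integral_add_adjacent_intervals
    (hfc.intervalIntegrable (-1) 0) (hfc.intervalIntegrable 0 1), h_even,
    ← intervalIntegral.integral_add (Continuous.intervalIntegrable (by fun_prop) _ _)
    (hfc.intervalIntegrable _ _), ← integral_one_sub_mul_cos, ← intervalIntegral.integral_ofReal]
  refine intervalIntegral.integral_congr fun t ht ↦ ?_
  rw [Set.uIcc_of_le zero_le_one] at ht
  simp only [hf, abs_neg, abs_of_nonneg ht.1]
  push_cast
  rw [Complex.cos]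
  ring_nf

theorem triangleTransform_add {F G : ℝ → ℂ} (hF : Continuous F) (hG : Continuous G) (w : ℝ) :
    triangleTransform (fun t ↦ F t + G t) w = triangleTransform F w + triangleTransform G w := by
  simp only [triangleTransform, mul_add]
  exact intervalIntegral.integral_add (Continuous.intervalIntegrable (by fun_prop) _ _)
    (Continuous.intervalIntegrable (by fun_prop) _ _)

theorem triangleTransform_const_mul (c : ℂ) (F : ℝ → ℂ) (w : ℝ) :
    triangleTransform (fun t ↦ c * F t) w = c * triangleTransform F w := by
  simp only [triangleTransform, mul_left_comm _ c, intervalIntegral.integral_const_mul]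

theorem triangleTransform_integral {α : Type*} [MeasurableSpace α] {μ : Measure α} [SFinite μ]
    {f : α → ℂ} (hf : Integrable f μ) {lam : α → ℝ} (hlam : Measurable lam) (w : ℝ) :
    triangleTransform
      (fun t ↦ ∫ x, f x * Complex.exp (-(2 * t * lam x * Complex.I)) ∂μ) w =
      ∫ x, f x * (Real.sinc (lam x - w) ^ 2 : ℝ) ∂μ := by
  have h_int : Integrable (fun z : ℝ × α ↦ ((1 - |z.1| : ℝ) : ℂ) *
      Complex.exp (2 * z.1 * w * Complex.I) *
      (f z.2 * Complex.exp (-(2 * z.1 * lam z.2 * Complex.I))))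
      ((volume.restrict (Set.Ioc (-1 : ℝ) 1)).prod μ) := by
    have h_tri : Integrable (fun t : ℝ ↦ ((1 - |t| : ℝ) : ℂ) * Complex.exp (2 * t * w * Complex.I))
        (volume.restrict (Set.Ioc (-1 : ℝ) 1)) :=
      (Continuous.integrableOn_Icc (by fun_prop)).mono_set Set.Ioc_subset_Icc_self
    have h_meas : AEStronglyMeasurable
        (fun z : ℝ × α ↦ Complex.exp (-(2 * z.1 * lam z.2 * Complex.I)))
        ((volume.restrict (Set.Ioc (-1 : ℝ) 1)).prod μ) :=
      Measurable.aestronglyMeasurable (by fun_prop)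
    simpa only [mul_assoc] using (h_tri.mul_prod hf).mul_bdd (c := 1) h_meas
      (Eventually.of_forall fun z ↦ by simp [Complex.norm_exp])
  simp only [triangleTransform, intervalIntegral.integral_of_le (show (-1 : ℝ) ≤ 1 by norm_num),
    ← integral_const_mul]
  rw [integral_integral_swap h_int]
  refine integral_congr_ae (Eventually.of_forall fun x ↦ ?_)
  simp only [← triangleTransform_exp, triangleTransform,
    intervalIntegral.integral_of_le (show (-1 : ℝ) ≤ 1 by norm_num), ← integral_const_mul,
    mul_left_comm]

theorem continuous_triangleTransform {X : Type*} [TopologicalSpace X] {F : X → ℝ → ℂ}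
    (hF : Continuous (Function.uncurry F)) (w : ℝ) :
    Continuous fun x ↦ triangleTransform (F x) w :=
  intervalIntegral.continuous_parametric_intervalIntegral_of_continuous' (by fun_prop) _ _

theorem tendsto_triangleTransform_atTop (F : ℝ → ℂ) :
    Tendsto (triangleTransform F) atTop (𝓝 0) := by
  have h := Real.tendsto_integral_exp_smul_cocompact
    ((Set.Ioc (-1 : ℝ) 1).indicator fun t ↦ ((1 - |t| : ℝ) : ℂ) * F t)
  have h2 : Tendsto (fun w : ℝ ↦ -(w / Real.pi)) atTop (cocompact ℝ) :=
    (tendsto_neg_atTop_atBot.comp (tendsto_id.atTop_div_const Real.pi_pos)).mono_right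
      atBot_le_cocompact
  refine (h.comp h2).congr fun w ↦ ?_
  rw [triangleTransform, intervalIntegral.integral_of_le (by norm_num), ← integral_indicator
    measurableSet_Ioc]
  refine integral_congr_ae (Eventually.of_forall fun t ↦ ?_)
  by_cases ht : t ∈ Set.Ioc (-1 : ℝ) 1
  · simp only [Set.indicator_of_mem ht, Circle.smul_def,
      Real.fourierChar_apply, smul_eq_mul]
    rw [mul_assoc ((1 - |t| : ℝ) : ℂ), mul_left_comm ((1 - |t| : ℝ) : ℂ)]
    congr 2
    push_cast
    have : (Real.pi : ℂ) ≠ 0 := Complex.ofReal_ne_zero.mpr Real.pi_ne_zero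
    field_simp
  · simp [Set.indicator_of_notMem ht]

/-! ### Primes in short intervals -/

theorem hasSum_of_tendsto_of_le {ι κ : Type*} {l : Filter ι} [l.NeBot] {f : ι → κ → ℝ} {g : κ → ℝ}
    {S : ι → ℝ} {S₀ : ℝ} (hf_nonneg : ∀ᶠ i in l, ∀ k, 0 ≤ f i k)
    (hf_le : ∀ᶠ i in l, ∀ k, f i k ≤ g k) (hf_lim : ∀ k, Tendsto (f · k) l (𝓝 (g k)))
    (hf_sum : ∀ᶠ i in l, HasSum (f i) (S i)) (hS : Tendsto S l (𝓝 S₀)) : HasSum g S₀ := by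
  have hg_nonneg (k : κ) : 0 ≤ g k :=
    ge_of_tendsto (hf_lim k) (hf_nonneg.mono fun i hi ↦ hi k)
  have hg_partial (s : Finset κ) : ∑ k ∈ s, g k ≤ S₀ :=
    le_of_tendsto_of_tendsto (tendsto_finsetSum s fun k _ ↦ hf_lim k) hS <| by
      filter_upwards [hf_nonneg, hf_sum] with i hi hsum
      exact sum_le_hasSum s (fun k _ ↦ hi k) hsum
  have hg : Summable g := summable_of_sum_le hg_nonneg hg_partial
  have h_ge : S₀ ≤ ∑' k, g k := le_of_tendsto hS <| by
    filter_upwards [hf_le, hf_sum] with i hi hsum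
    exact hasSum_le hi hsum hg.hasSum
  rw [h_ge.antisymm (hg.tsum_le_of_sum_le hg_partial)]
  exact hg.hasSum

theorem tendsto_integral_Ioi_exp_neg_mul {f : ℝ → ℝ} (hf : IntegrableOn f (Set.Ioi 0)) :
    Tendsto (fun η : ℝ ↦ ∫ v in Set.Ioi (0 : ℝ), Real.exp (-η * v) * f v) (𝓝[>] 0)
      (𝓝 (∫ v in Set.Ioi (0 : ℝ), f v)) := by
  refine tendsto_integral_filter_of_dominated_convergence (‖f ·‖) ?_ ?_ hf.norm ?_
  · exact Eventually.of_forall fun η ↦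
      (Continuous.aestronglyMeasurable (by fun_prop)).mul hf.aestronglyMeasurable
  · filter_upwards [self_mem_nhdsWithin] with η (hη : 0 < η)
    filter_upwards [ae_restrict_mem measurableSet_Ioi] with v (hv : 0 < v)
    rw [norm_mul, Real.norm_of_nonneg (Real.exp_pos _).le]
    exact mul_le_of_le_one_left (norm_nonneg _) (Real.exp_le_one_iff.mpr (by nlinarith))
  · refine Eventually.of_forall fun v ↦ ?_
    have h_cont : Continuous fun η : ℝ ↦ Real.exp (-η * v) * f v := by fun_prop
    simpa using (h_cont.tendsto 0).mono_left nhdsWithin_le_nhds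

theorem tendsto_integral_Ioi_comp_sub {f : ℝ → ℝ} (hf : Integrable f) (a : ℝ) :
    Tendsto (fun w : ℝ ↦ ∫ v in Set.Ioi a, f (v - w)) atTop (𝓝 (∫ v, f v)) := by
  have h_shift (w : ℝ) : ∫ v in Set.Ioi a, f (v - w) = ∫ v in Set.Ioi (a - w), f v := by
    rw [← (measurePreserving_sub_right volume w).setIntegral_preimage_emb
      (MeasurableEquiv.subRight w).measurableEmbedding f, Set.preimage_sub_const_Ioi,
      sub_add_cancel]
  simp only [h_shift]
  exact (aecover_Ioi (tendsto_atBot_add_const_left atTop a tendsto_neg_atTop_atBot))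
    |>.integral_tendsto_of_countably_generated hf

theorem term_add_mul_I (f : ℕ → ℂ) (s : ℂ) (t : ℝ) (n : ℕ) :
    LSeries.term f (s + t * Complex.I) n =
      LSeries.term f s n * Complex.exp (-(t * Real.log n * Complex.I)) := by
  rcases eq_or_ne n 0 with rfl | hn
  · simp
  · have hn0 : (n : ℂ) ≠ 0 := Nat.cast_ne_zero.mpr hn
    rw [LSeries.term_of_ne_zero hn, LSeries.term_of_ne_zero hn, Complex.cpow_add _ _ hn0,
      Complex.exp_neg, Complex.cpow_def_of_ne_zero hn0 (t * Complex.I), Complex.natCast_log,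
      div_mul_eq_div_div, div_eq_mul_inv _ (Complex.exp _)]
    ring_nf

theorem hasSum_term_mul_sinc_sq {f : ℕ → ℂ} {s : ℂ} (hf : LSeriesSummable f s) (R w : ℝ) :
    HasSum (fun n ↦ LSeries.term f s n * (Real.sinc (R * (Real.log n - w)) ^ 2 : ℝ))
      (triangleTransform (fun t ↦ LSeries f (s + (2 * t * R : ℝ) * Complex.I)) (R * w)) := by
  have h_int : Integrable (LSeries.term f s) Measure.count :=
    integrable_count_iff.mpr hf.norm
  have h_bdd (n : ℕ) : ‖((Real.sinc (R * (Real.log n - w)) ^ 2 : ℝ) : ℂ)‖ ≤ 1 := by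
    rw [Complex.norm_real, Real.norm_of_nonneg (sq_nonneg _)]
    exact sinc_sq_le_one _
  have h_int_sinc : Integrable
      (fun n ↦ LSeries.term f s n * (Real.sinc (R * (Real.log n - w)) ^ 2 : ℝ)) Measure.count :=
    h_int.mul_bdd Measurable.of_discrete.aestronglyMeasurable (Eventually.of_forall h_bdd)
  have h_int_exp (t : ℝ) : Integrable (fun n : ℕ ↦ LSeries.term f s n *
      Complex.exp (-(2 * t * (R * Real.log n : ℝ) * Complex.I))) Measure.count :=
    h_int.mul_bdd (c := 1) Measurable.of_discrete.aestronglyMeasurable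
      (Eventually.of_forall fun n ↦ by simp [Complex.norm_exp, -Complex.natCast_log])
  have h_LSeries (t : ℝ) : LSeries f (s + (2 * t * R : ℝ) * Complex.I) =
      ∫ n, LSeries.term f s n * Complex.exp (-(2 * t * (R * Real.log n : ℝ) * Complex.I))
        ∂Measure.count := by
    simp only [LSeries, term_add_mul_I, integral_countable (h_int_exp t), count_real_singleton,
      one_smul]
    exact tsum_congr fun n ↦ by push_cast; ring_nf
  simp only [h_LSeries, triangleTransform_integral h_int (lam := fun n : ℕ ↦ R * Real.log n)
    Measurable.of_discrete, ← mul_sub, integral_countable h_int_sinc, count_real_singleton,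
      one_smul]
  exact ((integrable_count_iff.mp h_int_sinc).of_norm).hasSum

theorem triangleTransform_one_div {η : ℝ} (hη : 0 < η) (R w : ℝ) :
    triangleTransform (fun t ↦ 1 / (η + (2 * t * R : ℝ) * Complex.I)) (R * w) =
      (∫ v in Set.Ioi (0 : ℝ), Real.exp (-η * v) * Real.sinc (R * (v - w)) ^ 2 : ℝ) := by
  have h_laplace (t : ℝ) : 1 / (η + (2 * t * R : ℝ) * Complex.I) =
      ∫ v in Set.Ioi (0 : ℝ), (Real.exp (-η * v) : ℂ) *
        Complex.exp (-(2 * t * (R * v : ℝ) * Complex.I)) := by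
    have h := integral_exp_mul_complex_Ioi
      (a := -(η + (2 * t * R : ℝ) * Complex.I)) (by simpa using hη) 0
    rw [Complex.ofReal_zero, mul_zero, Complex.exp_zero, neg_div_neg_eq] at h
    rw [← h]
    refine integral_congr_ae (Eventually.of_forall fun v ↦ ?_)
    simp only [Complex.ofReal_exp, ← Complex.exp_add]
    push_cast
    ring_nf
  have h_int : Integrable (fun v : ℝ ↦ (Real.exp (-η * v) : ℂ))
      (volume.restrict (Set.Ioi (0 : ℝ))) :=
    (integrableOn_exp_mul_Ioi (neg_neg_of_pos hη) 0).ofReal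
  simp only [h_laplace]
  rw [triangleTransform_integral h_int (lam := fun v ↦ R * v) (by fun_prop),
    ← integral_complex_ofReal]
  simp only [mul_sub, Complex.ofReal_mul]


theorem div_rpow_one_add_le (n : ℕ) {b η : ℝ} (hb : 0 ≤ b) (hη : 0 ≤ η) :
    b / (n : ℝ) ^ (1 + η) ≤ b / n := by
  rcases n.eq_zero_or_pos with rfl | hn
  · simp [Real.zero_rpow (by positivity : 1 + η ≠ 0)]
  · gcongr
    exact Real.self_le_rpow_of_one_le (by exact_mod_cast hn) (by linarith)

theorem tendsto_div_rpow_one_add (n : ℕ) (b : ℝ) :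
    Tendsto (fun η : ℝ ↦ b / (n : ℝ) ^ (1 + η)) (𝓝[>] 0) (𝓝 (b / n)) := by
  rcases eq_or_ne n 0 with rfl | hn
  · refine tendsto_const_nhds.congr' ?_
    filter_upwards [self_mem_nhdsWithin] with η (hη : 0 < η)
    simp [Real.zero_rpow (by positivity : 1 + η ≠ 0)]
  · have hpow (η : ℝ) : (n : ℝ) ^ (1 + η) ≠ 0 := by positivity
    have hcont : Continuous fun η : ℝ ↦ b / (n : ℝ) ^ (1 + η) := by
      have : (n : ℝ) ≠ 0 := Nat.cast_ne_zero.mpr hn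
      fun_prop (disch := assumption)
    simpa using (hcont.tendsto 0).mono_left nhdsWithin_le_nhds

theorem tendsto_sinc_cocompact : Tendsto Real.sinc (cocompact ℝ) (𝓝 0) := by
  refine squeeze_zero_norm' ?_ (tendsto_inv_atTop_zero.comp (tendsto_norm_cocompact_atTop (E := ℝ)))
  filter_upwards [(Set.finite_singleton (0 : ℝ)).isCompact.compl_mem_cocompact] with u hu
  rw [Real.sinc_of_ne_zero hu, norm_div, Function.comp_apply, ← one_div]
  gcongr
  exact Real.abs_sin_le_one u

theorem tendsto_tsum_mul_sinc_sq_of_summable {ι : Type*} {b : ι → ℝ} (hb : Summable b)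
    (lam : ι → ℝ) {R : ℝ} (hR : 0 < R) :
    Tendsto (fun w ↦ ∑' i, b i * Real.sinc (R * (lam i - w)) ^ 2) atTop (𝓝 0) := by
  have h_lim (i : ι) : Tendsto (fun w ↦ b i * Real.sinc (R * (lam i - w)) ^ 2) atTop (𝓝 0) := by
    have h_arg : Tendsto (fun w ↦ R * (lam i - w)) atTop atBot :=
      (tendsto_atBot_add_const_left atTop (lam i) tendsto_neg_atTop_atBot).const_mul_atBot hR
    simpa using
      (((tendsto_sinc_cocompact.mono_left atBot_le_cocompact).comp h_arg).pow 2).const_mul (b i)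
  simpa using tendsto_tsum_of_dominated_convergence hb.norm h_lim (Eventually.of_forall fun w i ↦ by
    rw [norm_mul, Real.norm_of_nonneg (sq_nonneg _)]
    exact mul_le_of_le_one_right (norm_nonneg _) (sinc_sq_le_one _))

theorem tsum_mul_sinc_sq_le {ι : Type*} {c lam : ι → ℝ} (hc : ∀ i, 0 ≤ c i) {S : Set ι} {δ R w : ℝ}
    (hδ : 0 < δ) (hR : R ≠ 0) (hS : ∀ i ∈ S, δ ≤ |lam i - w|) (hcS : Summable (Sᶜ.indicator c))
    (hsum : ∀ v, Summable fun i ↦ c i * Real.sinc (1 * (lam i - v)) ^ 2) :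
    ∑' i, c i * Real.sinc (R * (lam i - w)) ^ 2 ≤
      ∑' i, Sᶜ.indicator c i * Real.sinc (R * (lam i - w)) ^ 2 +
        (1 + Real.pi / 2 / δ) ^ 2 / R ^ 2 *
          (∑' i, c i * Real.sinc (1 * (lam i - w)) ^ 2 +
            ∑' i, c i * Real.sinc (1 * (lam i - (w - Real.pi / 2))) ^ 2) := by
  set M := (1 + Real.pi / 2 / δ) ^ 2 / R ^ 2
  have : 0 ≤ M := by positivity
  have h_le (i : ι) : c i * Real.sinc (R * (lam i - w)) ^ 2 ≤
      Sᶜ.indicator c i * Real.sinc (R * (lam i - w)) ^ 2 +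
        M * (c i * Real.sinc (1 * (lam i - w)) ^ 2 +
          c i * Real.sinc (1 * (lam i - (w - Real.pi / 2))) ^ 2) := by
    by_cases hi : i ∈ S
    · have h := mul_le_mul_of_nonneg_left (sinc_sq_comp_mul_le hδ hR (hS i hi)) (hc i)
      rw [Set.indicator_of_notMem (by simpa using hi), zero_mul, zero_add, one_mul, one_mul,
        sub_sub_eq_add_sub, add_sub_right_comm]
      linarith
    · rw [Set.indicator_of_mem (by simpa using hi)]
      have := hc i
      exact le_add_of_nonneg_right (by positivity)
  have h_off : Summable fun i ↦ Sᶜ.indicator c i * Real.sinc (R * (lam i - w)) ^ 2 :=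
    hcS.of_nonneg_of_le (fun i ↦ mul_nonneg (Set.indicator_nonneg (fun i _ ↦ hc i) i) (sq_nonneg _))
      fun i ↦ mul_le_of_le_one_right (Set.indicator_nonneg (fun i _ ↦ hc i) i) (sinc_sq_le_one _)
  have h_tail := ((hsum w).add (hsum (w - Real.pi / 2))).mul_left M
  have h_left : Summable fun i ↦ c i * Real.sinc (R * (lam i - w)) ^ 2 :=
    (h_off.add h_tail).of_nonneg_of_le (fun i ↦ mul_nonneg (hc i) (sq_nonneg _)) h_le
  rw [← (hsum w).tsum_add (hsum _), ← tsum_mul_left, ← h_off.tsum_add h_tail]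
  exact h_left.tsum_le_tsum h_le (h_off.add h_tail)

section Tauberian

variable {a : ℕ → ℝ} {A : ℝ} {G : ℂ → ℂ}

theorem hasSum_div_rpow_mul_sinc_sq
    (habs : LSeries.abscissaOfAbsConv (fun n ↦ (a n : ℂ)) ≤ 1)
    (hGc : ContinuousOn G {s | 1 ≤ s.re})
    (hG : Set.EqOn G (fun s ↦ LSeries (fun n ↦ (a n : ℂ)) s - A / (s - 1)) {s | 1 < s.re})
    {η : ℝ} (hη : 0 < η) (R w : ℝ) :
    HasSum (fun n : ℕ ↦ a n / (n : ℝ) ^ (1 + η) * Real.sinc (R * (Real.log n - w)) ^ 2)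
      ((triangleTransform (fun t ↦ G (1 + η + (2 * t * R : ℝ) * Complex.I)) (R * w)).re +
        A * ∫ v in Set.Ioi (0 : ℝ), Real.exp (-η * v) * Real.sinc (R * (v - w)) ^ 2) := by
  have h_summable : LSeriesSummable (fun n ↦ (a n : ℂ)) (1 + η) :=
    LSeriesSummable_of_abscissaOfAbsConv_lt_re (habs.trans_lt (mod_cast
      (by simpa using hη : 1 < (1 + (η : ℂ)).re)))
  have h_LSeries (t : ℝ) : LSeries (fun n ↦ (a n : ℂ)) (1 + η + (2 * t * R : ℝ) * Complex.I) =
      G (1 + η + (2 * t * R : ℝ) * Complex.I) +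
        A * (1 / (η + (2 * t * R : ℝ) * Complex.I)) := by
    rw [hG (by simpa using hη)]
    ring_nf
  have hG_cont : Continuous fun t : ℝ ↦ G (1 + η + (2 * t * R : ℝ) * Complex.I) :=
    hGc.comp_continuous (by fun_prop) fun t ↦ by simpa using hη.le
  have h_pole_cont : Continuous fun t : ℝ ↦ (A : ℂ) * (1 / (η + (2 * t * R : ℝ) * Complex.I)) := by
    refine continuous_const.mul (continuous_const.div (by fun_prop) fun t h ↦ hη.ne' ?_)
    simpa using congrArg Complex.re h
  have h := Complex.hasSum_re (hasSum_term_mul_sinc_sq h_summable R w)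
  simp only [h_LSeries, triangleTransform_add hG_cont h_pole_cont, triangleTransform_const_mul,
    triangleTransform_one_div hη, ← Complex.ofReal_mul, Complex.add_re, Complex.ofReal_re] at h
  refine h.congr_fun fun n ↦ ?_
  rw [Complex.re_mul_ofReal]
  congr 1
  rcases eq_or_ne n 0 with rfl | hn
  · simp [Real.zero_rpow (by linarith : 1 + η ≠ 0)]
  · rw [LSeries.term_of_ne_zero hn, ← Complex.ofReal_one, ← Complex.ofReal_add,
      ← Complex.ofReal_natCast, ← Complex.ofReal_cpow n.cast_nonneg, ← Complex.ofReal_div,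
      Complex.ofReal_re]

theorem hasSum_mul_sinc_sq (ha : ∀ n, 0 ≤ a n)
    (habs : LSeries.abscissaOfAbsConv (fun n ↦ (a n : ℂ)) ≤ 1)
    (hGc : ContinuousOn G {s | 1 ≤ s.re})
    (hG : Set.EqOn G (fun s ↦ LSeries (fun n ↦ (a n : ℂ)) s - A / (s - 1)) {s | 1 < s.re})
    {R : ℝ} (hR : R ≠ 0) (w : ℝ) :
    HasSum (fun n : ℕ ↦ a n / n * Real.sinc (R * (Real.log n - w)) ^ 2)
      ((triangleTransform (fun t ↦ G (1 + (2 * t * R : ℝ) * Complex.I)) (R * w)).re +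
        A * ∫ v in Set.Ioi (0 : ℝ), Real.sinc (R * (v - w)) ^ 2) := by
  set K : ℝ → ℝ := fun v ↦ Real.sinc (R * (v - w)) ^ 2
  have hG_cont : Continuous fun z : ℝ × ℝ ↦
      G (1 + (max z.1 0 : ℝ) + (2 * z.2 * R : ℝ) * Complex.I) :=
    hGc.comp_continuous (by fun_prop) fun z ↦ by simp
  set B : ℝ → ℂ := fun η ↦
    triangleTransform (fun t ↦ G (1 + (max η 0 : ℝ) + (2 * t * R : ℝ) * Complex.I)) (R * w)
  have hB : Tendsto (fun η ↦ (B η).re) (𝓝[>] 0)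
      (𝓝 (triangleTransform (fun t ↦ G (1 + (2 * t * R : ℝ) * Complex.I)) (R * w)).re) := by
    have h := (Complex.continuous_re.comp (continuous_triangleTransform (F := fun η t ↦
      G (1 + (max η 0 : ℝ) + (2 * t * R : ℝ) * Complex.I)) hG_cont (R * w))).tendsto 0
    simpa [B, Function.comp_def] using h.mono_left nhdsWithin_le_nhds
  have h_pole := (tendsto_integral_Ioi_exp_neg_mul
    (integrable_sinc_sq_comp_mul_sub hR w).integrableOn).const_mul A
  refine hasSum_of_tendsto_of_le (l := 𝓝[>] (0 : ℝ))
    (f := fun η n ↦ a n / (n : ℝ) ^ (1 + η) * K (Real.log n)) ?_ ?_ (fun n ↦ ?_) ?_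
    (hB.add h_pole)
  · exact Eventually.of_forall fun η n ↦ by positivity [ha n]
  · filter_upwards [self_mem_nhdsWithin] with η (hη : 0 < η) n
    exact mul_le_mul_of_nonneg_right (div_rpow_one_add_le n (ha n) hη.le) (sq_nonneg _)
  · exact (tendsto_div_rpow_one_add n (a n)).mul_const _
  · filter_upwards [self_mem_nhdsWithin] with η (hη : 0 < η)
    simpa only [B, max_eq_left hη.le] using hasSum_div_rpow_mul_sinc_sq habs hGc hG hη R w

theorem tendsto_tsum_mul_sinc_sq (ha : ∀ n, 0 ≤ a n)
    (habs : LSeries.abscissaOfAbsConv (fun n ↦ (a n : ℂ)) ≤ 1)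
    (hGc : ContinuousOn G {s | 1 ≤ s.re})
    (hG : Set.EqOn G (fun s ↦ LSeries (fun n ↦ (a n : ℂ)) s - A / (s - 1)) {s | 1 < s.re})
    {R : ℝ} (hR : 0 < R) :
    Tendsto (fun w ↦ ∑' n : ℕ, a n / n * Real.sinc (R * (Real.log n - w)) ^ 2) atTop
      (𝓝 (A * ((∫ u : ℝ, Real.sinc u ^ 2) / R))) := by
  simp only [(hasSum_mul_sinc_sq ha habs hGc hG hR.ne' _).tsum_eq]
  have h_regular := ((Complex.continuous_re.tendsto' 0 0 rfl).comp (tendsto_triangleTransform_atTop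
    fun t ↦ G (1 + (2 * t * R : ℝ) * Complex.I))).comp (tendsto_id.const_mul_atTop hR)
  have h_pole := (tendsto_integral_Ioi_comp_sub
    (integrable_sinc_sq.comp_mul_left' hR.ne') 0).const_mul A
  rw [integral_sinc_sq_comp_mul hR] at h_pole
  simpa using h_regular.add h_pole

theorem eventually_exists_mem_abs_log_sub_lt (ha : ∀ n, 0 ≤ a n)
    (habs : LSeries.abscissaOfAbsConv (fun n ↦ (a n : ℂ)) ≤ 1)
    (hGc : ContinuousOn G {s | 1 ≤ s.re})
    (hG : Set.EqOn G (fun s ↦ LSeries (fun n ↦ (a n : ℂ)) s - A / (s - 1)) {s | 1 < s.re})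
    (hA : 0 < A) {S : Set ℕ} (hS : Summable (Sᶜ.indicator fun n ↦ a n / n))
    {δ : ℝ} (hδ : 0 < δ) :
    ∀ᶠ w : ℝ in atTop, ∃ n ∈ S, |Real.log n - w| < δ := by
  set J := ∫ u : ℝ, Real.sinc u ^ 2
  have hJ : 0 < J := integral_sinc_sq_pos
  set C := (1 + Real.pi / 2 / δ) ^ 2
  set R := 4 * C
  have hC : 0 < C := by positivity
  have hR : 0 < R := by positivity
  have h_near := tendsto_tsum_mul_sinc_sq ha habs hGc hG hR
  have h_one := tendsto_tsum_mul_sinc_sq ha habs hGc hG one_pos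
  have h_far := (tendsto_tsum_mul_sinc_sq_of_summable hS (fun n ↦ Real.log n) hR).add
    ((h_one.add (h_one.comp (tendsto_atTop_add_const_right atTop (-(Real.pi / 2))
      tendsto_id))).const_mul (C / R ^ 2))
  have h_lt : 0 + C / R ^ 2 * (A * (J / 1) + A * (J / 1)) < A * (J / R) := by
    simp only [R]
    field_simp
    linarith [mul_pos hA hJ]
  filter_upwards [h_far.eventually_lt h_near h_lt] with w hw
  by_contra! hno
  exact hw.not_ge (tsum_mul_sinc_sq_le (fun n ↦ div_nonneg (ha n) n.cast_nonneg) hδ hR.ne' hno hS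
    fun v ↦ (hasSum_mul_sinc_sq ha habs hGc hG one_ne_zero v).summable)

end Tauberian

open ArithmeticFunction.vonMangoldt in
theorem eventually_exists_prime_eq_mod_abs_log_sub_lt {q : ℕ} [NeZero q] {a : ZMod q}
    (ha : IsUnit a) {δ : ℝ} (hδ : 0 < δ) :
    ∀ᶠ w : ℝ in atTop, ∃ p : ℕ, p.Prime ∧ (p : ZMod q) = a ∧ |Real.log p - w| < δ := by
  have hS : Summable ({p : ℕ | p.Prime ∧ (p : ZMod q) = a}ᶜ.indicator
      fun n ↦ residueClass a n / n) := by
    refine (summable_residueClass_non_primes_div a).congr fun n ↦ ?_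
    by_cases hn : n.Prime <;> by_cases hna : (n : ZMod q) = a <;>
      simp [Set.indicator_apply, residueClass, hn, hna]
  refine (eventually_exists_mem_abs_log_sub_lt (A := (q.totient : ℝ)⁻¹) (residueClass_nonneg a)
    (abscissaOfAbsConv_residueClass_le_one a) (continuousOn_LFunctionResidueClassAux a)
    (by simpa using eqOn_LFunctionResidueClassAux ha)
    (inv_pos.mpr (mod_cast Nat.totient_pos.mpr (NeZero.pos q))) hS hδ).mono ?_
  rintro w ⟨p, ⟨hp, hpa⟩, hpw⟩
  exact ⟨p, hp, hpa, hpw⟩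

theorem eventually_exists_prime_mem_Ioo {c : ℝ} (hc : 1 < c) :
    ∀ᶠ x : ℝ in atTop, ∃ p : ℕ, p.Prime ∧ x < p ∧ p < c * x := by
  have hδ : 0 < Real.log c / 2 := half_pos (Real.log_pos hc)
  have h_prime := (tendsto_atTop_add_const_right atTop (Real.log c / 2)
    Real.tendsto_log_atTop).eventually
    (eventually_exists_prime_eq_mod_abs_log_sub_lt (q := 1) isUnit_one hδ)
  filter_upwards [h_prime, eventually_gt_atTop 0] with x ⟨p, hp, _, hpx⟩ hx
  have hp0 : (0 : ℝ) < p := mod_cast hp.pos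
  rw [abs_lt] at hpx
  refine ⟨p, hp, (Real.log_lt_log_iff hx hp0).mp (by linarith),
    (Real.log_lt_log_iff hp0 (by positivity)).mp ?_⟩
  rw [Real.log_mul (by positivity) hx.ne']
  linarith

theorem primeCeil_le {x : ℝ} {p : ℕ} (hp : p.Prime) (hx : x ≤ p) : primeCeil x ≤ p :=
  Nat.sInf_le ⟨hp, hx⟩

theorem tendsto_primeCeil_div_self : Tendsto (fun x : ℝ ↦ primeCeil x / x) atTop (𝓝 1) := by
  refine tendsto_order.mpr ⟨fun c hc ↦ ?_, fun c hc ↦ ?_⟩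
  · filter_upwards [eventually_gt_atTop 0] with x hx
    exact hc.trans_le ((one_le_div₀ hx).mpr (primeCeil_spec x).2)
  · filter_upwards [eventually_exists_prime_mem_Ioo hc, eventually_gt_atTop 0]
      with x ⟨p, hp, hxp, hpc⟩ hx
    rw [div_lt_iff₀ hx]
    exact (Nat.cast_le.mpr (primeCeil_le hp hxp.le)).trans_lt hpc

theorem tendsto_primeCeil_mul_div {y : ℝ} (hy : 0 < y) :
    Tendsto (fun X : ℝ ↦ primeCeil (y * X) / X) atTop (𝓝 y) := by
  have h := (tendsto_primeCeil_div_self.comp (tendsto_id.const_mul_atTop hy)).const_mul y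
  rw [mul_one] at h
  refine h.congr fun X ↦ ?_
  simp only [Function.comp_apply, id_eq]
  field_simp

/-! ### Mean values of arithmetic functions -/

theorem sum_Icc_floor_ite_dvd {M : Type*} [AddCommMonoid M] (f : ℕ → M) {k : ℕ} (hk : 0 < k)
    (x : ℝ) :
    ∑ n ∈ Finset.Icc 0 ⌊x⌋₊, (if k ∣ n then f n else 0) =
      ∑ n ∈ Finset.Icc 0 ⌊x / k⌋₊, f (k * n) := by
  rw [← Finset.sum_filter, Nat.floor_div_natCast]
  refine (Finset.sum_nbij (k * ·) (fun n hn ↦ ?_) (fun a _ b _ h ↦ ?_) (fun n hn ↦ ?_)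
    fun _ _ ↦ rfl).symm
  · rw [Finset.mem_Icc, Nat.le_div_iff_mul_le hk] at hn
    rw [Finset.mem_filter, Finset.mem_Icc]
    exact ⟨⟨Nat.zero_le _, by linarith⟩, dvd_mul_right k n⟩
  · exact Nat.eq_of_mul_eq_mul_left hk h
  · simp only [Finset.coe_filter, Finset.mem_Icc, Set.mem_ofPred_eq] at hn
    obtain ⟨⟨-, hn⟩, l, rfl⟩ := hn
    exact ⟨l, by simpa [Nat.le_div_iff_mul_le hk, mul_comm] using hn, rfl⟩

/-- The arithmetic function `f` has mean value `m`. The sums start at `n = 0`, as in Mathlib's Abel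
summation formulas; this does not affect `m`. -/
def HasMeanValue {E : Type*} [NormedAddCommGroup E] [NormedSpace ℝ E] (f : ℕ → E) (m : E) : Prop :=
  Tendsto (fun x : ℝ ↦ x⁻¹ • ∑ n ∈ Finset.Icc 0 ⌊x⌋₊, f n) atTop (𝓝 m)

section MeanValue

variable {E F : Type*} [NormedAddCommGroup E] [NormedSpace ℝ E] [NormedAddCommGroup F]
  [NormedSpace ℝ F] {f g : ℕ → E} {m m' : E}

theorem HasMeanValue.add (hf : HasMeanValue f m) (hg : HasMeanValue g m') :
    HasMeanValue (fun n ↦ f n + g n) (m + m') := by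
  refine (Tendsto.add hf hg).congr fun x ↦ ?_
  rw [← smul_add, Finset.sum_add_distrib]

theorem HasMeanValue.map (hf : HasMeanValue f m) (L : E →L[ℝ] F) :
    HasMeanValue (fun n ↦ L (f n)) (L m) := by
  refine ((L.continuous.tendsto m).comp hf).congr fun x ↦ ?_
  simp only [Function.comp_apply, map_smul, map_sum]

theorem HasMeanValue.const_smul (hf : HasMeanValue f m) (r : ℝ) :
    HasMeanValue (fun n ↦ r • f n) (r • m) :=
  hf.map (r • ContinuousLinearMap.id ℝ E)

theorem HasMeanValue.ite_dvd (hf : HasMeanValue f m) {k : ℕ} (hk : 0 < k)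
    (hfk : ∀ n, f (k * n) = f n) :
    HasMeanValue (fun n ↦ if k ∣ n then f n else 0) ((k : ℝ)⁻¹ • m) := by
  have hk' : (0 : ℝ) < k := by exact_mod_cast hk
  refine ((hf.comp (tendsto_id.atTop_div_const hk')).const_smul (k : ℝ)⁻¹).congr fun x ↦ ?_
  simp only [sum_Icc_floor_ite_dvd f hk, hfk, Function.comp_apply, id_eq, smul_smul]
  congr 1
  field_simp

end MeanValue

theorem tendsto_floor_nat_div_div (d : ℕ) :
    Tendsto (fun x : ℝ ↦ ((⌊x⌋₊ / d : ℕ) : ℝ) / x) atTop (𝓝 (1 / d)) := by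
  refine (tendsto_nat_floor_mul_div_atTop (by positivity : (0 : ℝ) ≤ 1 / d)).congr fun x ↦ ?_
  rw [one_div_mul_eq_div, Nat.floor_div_natCast]

theorem sum_Icc_mul_zeta_eq_tsum (g : ArithmeticFunction ℝ) (N : ℕ) :
    ∑ n ∈ Finset.Icc 0 N, (g * ArithmeticFunction.zeta) n = ∑' d, g d * (N / d : ℕ) := by
  rw [← Finset.add_sum_Ioc_eq_sum_Icc (Nat.zero_le N), ArithmeticFunction.map_zero, zero_add,
    ArithmeticFunction.sum_Ioc_mul_zeta_eq_sum, tsum_eq_sum fun d hd ↦ ?_]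
  rcases Nat.eq_zero_or_pos d with rfl | hd0
  · simp
  · have hN : N < d := by simpa [hd0] using hd
    simp [Nat.div_eq_of_lt hN]

/-- Wintner's theorem. -/
theorem hasMeanValue_mul_zeta {g : ArithmeticFunction ℝ} (hg : Summable fun d ↦ g d / d) :
    HasMeanValue (g * ArithmeticFunction.zeta : ArithmeticFunction ℝ) (∑' d, g d / d) := by
  simp only [HasMeanValue, sum_Icc_mul_zeta_eq_tsum, ← tsum_const_smul'']
  refine tendsto_tsum_of_dominated_convergence hg.norm (fun d ↦ ?_) ?_
  · rw [← mul_one_div]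
    refine ((tendsto_floor_nat_div_div d).const_mul (g d)).congr fun x ↦ ?_
    rw [smul_eq_mul]
    ring
  · filter_upwards [eventually_gt_atTop 0] with x hx d
    have hle : ((⌊x⌋₊ / d : ℕ) : ℝ) ≤ x / d :=
      Nat.cast_div_le.trans (by gcongr; exact Nat.floor_le hx.le)
    calc ‖x⁻¹ • (g d * ((⌊x⌋₊ / d : ℕ) : ℝ))‖ = x⁻¹ * (‖g d‖ * (⌊x⌋₊ / d : ℕ)) := by
          rw [norm_smul, norm_mul, Real.norm_natCast, Real.norm_of_nonneg (inv_pos.2 hx).le]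
      _ ≤ x⁻¹ * (‖g d‖ * (x / d)) := by gcongr
      _ = ‖g d / d‖ := by rw [norm_div, Real.norm_natCast]; field_simp

open ArithmeticFunction in
theorem totient_div_eq_sum_moebius_div {n : ℕ} (hn : n ≠ 0) :
    (n.totient : ℝ) / n = ∑ d ∈ n.divisors, (moebius d : ℝ) / d := by
  have hinv := (sum_eq_iff_sum_mul_moebius_eq (R := ℝ) (f := fun n ↦ (n.totient : ℝ))
    (g := fun n ↦ (n : ℝ))).mp (fun n _ ↦ by exact_mod_cast Nat.sum_totient n) n
    (Nat.pos_of_ne_zero hn)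
  rw [← hinv, Finset.sum_div, Nat.sum_divisorsAntidiagonal
    (fun d e ↦ (moebius d : ℝ) * (e : ℝ) / n)]
  refine Finset.sum_congr rfl fun d hd ↦ ?_
  have hd0 : (d : ℝ) ≠ 0 := by exact_mod_cast (Nat.pos_of_mem_divisors hd).ne'
  rw [Nat.cast_div (Nat.dvd_of_mem_divisors hd) hd0]
  field_simp

/-- The arithmetic function equal to `μ(d) / d` at odd `d` and to `0` at even `d`. Its sum over the
divisors of `n` is the product of `1 - 1 / p` over the odd primes `p ∣ n`. -/
noncomputable def oddMoebiusDiv : ArithmeticFunction ℝ where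
  toFun d := if Odd d then (ArithmeticFunction.moebius d : ℝ) / d else 0
  map_zero' := by simp

theorem oddMoebiusDiv_apply (d : ℕ) :
    oddMoebiusDiv d = if Odd d then (ArithmeticFunction.moebius d : ℝ) / d else 0 := rfl

/-- The product of `1 - 1 / p` over the odd primes `p ∣ n`, for `n ≠ 0`, written as the divisor sum
of `oddMoebiusDiv`. -/
noncomputable def oddTotientRatio : ArithmeticFunction ℝ := oddMoebiusDiv * ArithmeticFunction.zeta

theorem oddTotientRatio_apply (n : ℕ) :
    oddTotientRatio n = ∑ d ∈ n.divisors with Odd d, (ArithmeticFunction.moebius d : ℝ) / d := by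
  simp only [oddTotientRatio, ArithmeticFunction.coe_mul_zeta_apply, oddMoebiusDiv_apply,
    Finset.sum_filter]

theorem oddTotientRatio_two_mul (n : ℕ) : oddTotientRatio (2 * n) = oddTotientRatio n := by
  rw [oddTotientRatio_apply, oddTotientRatio_apply]
  congr 1
  ext d
  simp only [Finset.mem_filter, Nat.mem_divisors, and_congr_left_iff]
  intro hd
  simp [hd.coprime_two_right.dvd_mul_left]

theorem totient_div_eq_oddTotientRatio {n : ℕ} (hn : Odd n) :
    (n.totient : ℝ) / n = oddTotientRatio n := by
  rw [totient_div_eq_sum_moebius_div hn.pos.ne', oddTotientRatio_apply, Finset.filter_true_of_mem]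
  exact fun d hd ↦ hn.of_dvd_nat (Nat.dvd_of_mem_divisors hd)

theorem totient_div_two_mul {n : ℕ} (hn : n ≠ 0) :
    ((2 * n).totient : ℝ) / (2 * n : ℕ) = oddTotientRatio n / 2 := by
  induction n using Nat.strong_induction_on with
  | _ n ih =>
    rcases n.even_or_odd' with ⟨m, rfl | rfl⟩
    · have hm : m ≠ 0 := by omega
      rw [Nat.totient_two_mul_of_even (even_two_mul m), oddTotientRatio_two_mul,
        ← ih m (by omega) hm]
      push_cast
      exact mul_div_mul_left _ _ two_ne_zero
    · have hodd : Odd (2 * m + 1) := odd_two_mul_add_one m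
      rw [Nat.totient_two_mul_of_odd hodd, ← totient_div_eq_oddTotientRatio hodd]
      push_cast
      field_simp

/-- `φ(n) / n` off the residue class `2` modulo `4`, and `0` on it. -/
noncomputable def totientWeight (n : ℕ) : ℝ := if n ≡ 2 [MOD 4] then 0 else (n.totient : ℝ) / n

theorem totientWeight_eq (n : ℕ) :
    totientWeight n = oddTotientRatio n + (-1 : ℝ) • (if 2 ∣ n then oddTotientRatio n else 0) +
      (1 / 2 : ℝ) • (if 4 ∣ n then oddTotientRatio n else 0) := by
  have hmod : n ≡ 2 [MOD 4] ↔ n % 4 = 2 := Iff.rfl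
  rw [totientWeight, smul_eq_mul, smul_eq_mul]
  rcases n.even_or_odd' with ⟨m, rfl | rfl⟩
  · rcases eq_or_ne m 0 with rfl | hm
    · simp
    rw [totient_div_two_mul hm, oddTotientRatio_two_mul, if_pos (dvd_mul_right 2 m)]
    by_cases h4 : 4 ∣ 2 * m
    · rw [if_pos h4, if_neg (mt hmod.1 (by omega))]
      ring
    · rw [if_neg h4, if_pos (hmod.2 (by omega))]
      ring
  · rw [totient_div_eq_oddTotientRatio (odd_two_mul_add_one m), if_neg (mt hmod.1 (by omega)),
      if_neg (by omega), if_neg (by omega)]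
    ring

theorem summable_moebius_div_sq :
    Summable fun d : ℕ ↦ (ArithmeticFunction.moebius d : ℝ) / (d : ℝ) ^ 2 := by
  refine Summable.of_norm_bounded (Real.summable_one_div_nat_pow.mpr one_lt_two) fun d ↦ ?_
  have hμ : |(ArithmeticFunction.moebius d : ℝ)| ≤ 1 := by
    exact_mod_cast ArithmeticFunction.abs_moebius_le_one
  rw [norm_div, Real.norm_eq_abs, norm_pow, Real.norm_natCast]
  gcongr

theorem tsum_moebius_div_sq :
    ∑' d : ℕ, (ArithmeticFunction.moebius d : ℝ) / (d : ℝ) ^ 2 = 6 / Real.pi ^ 2 := by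
  have hζ := ArithmeticFunction.LSeries_zeta_mul_Lseries_moebius (s := 2) (by norm_num)
  rw [ArithmeticFunction.LSeries_zeta_eq_riemannZeta (by norm_num), riemannZeta_two] at hζ
  have hμ : LSeries (fun n ↦ ((ArithmeticFunction.moebius n : ℤ) : ℂ)) 2 =
      ((∑' d : ℕ, (ArithmeticFunction.moebius d : ℝ) / (d : ℝ) ^ 2 : ℝ) : ℂ) := by
    rw [Complex.ofReal_tsum, LSeries]
    refine tsum_congr fun n ↦ ?_
    rcases eq_or_ne n 0 with rfl | hn
    · simp
    · rw [LSeries.term_of_ne_zero hn]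
      norm_cast
  rw [hμ] at hζ
  rw [eq_div_iff (pow_ne_zero 2 Real.pi_ne_zero)]
  have hζ' : Real.pi ^ 2 / 6 *
      ∑' d : ℕ, (ArithmeticFunction.moebius d : ℝ) / (d : ℝ) ^ 2 = 1 := by
    exact_mod_cast hζ
  linarith

theorem moebius_two_mul_div_sq (m : ℕ) :
    (ArithmeticFunction.moebius (2 * m) : ℝ) / ((2 * m : ℕ) : ℝ) ^ 2 =
      -(1 / 4) * (oddMoebiusDiv m / m) := by
  rw [oddMoebiusDiv_apply]
  split_ifs with hm
  · rw [ArithmeticFunction.isMultiplicative_moebius.map_mul_of_coprime hm.coprime_two_left,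
      ArithmeticFunction.moebius_apply_prime Nat.prime_two]
    push_cast
    ring
  · have hsq : ¬ Squarefree (2 * m) := by
      obtain ⟨l, rfl⟩ := (Nat.not_odd_iff_even.1 hm).two_dvd
      exact fun h ↦ Nat.prime_two.not_isUnit (h 2 ⟨l, by ring⟩)
    simp [ArithmeticFunction.moebius_eq_zero_of_not_squarefree hsq]

theorem oddMoebiusDiv_two_mul (m : ℕ) : oddMoebiusDiv (2 * m) = 0 :=
  if_neg (Nat.not_odd_iff_even.2 (even_two_mul m))

theorem oddMoebiusDiv_two_mul_add_one (m : ℕ) :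
    oddMoebiusDiv (2 * m + 1) = (ArithmeticFunction.moebius (2 * m + 1) : ℝ) / (2 * m + 1 : ℕ) :=
  if_pos (odd_two_mul_add_one m)

theorem summable_oddMoebiusDiv_div : Summable fun d ↦ oddMoebiusDiv d / d := by
  refine Summable.of_norm_bounded summable_moebius_div_sq.norm fun d ↦ ?_
  rw [oddMoebiusDiv_apply]
  split_ifs
  · rw [div_div, ← sq]
  · rw [zero_div, norm_zero]
    exact norm_nonneg _

theorem tsum_oddMoebiusDiv_div : ∑' d, oddMoebiusDiv d / d = 8 / Real.pi ^ 2 := by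
  have heven : Function.Injective fun k : ℕ ↦ 2 * k := fun a b h ↦ by simpa using h
  have hodd : Function.Injective fun k : ℕ ↦ 2 * k + 1 := fun a b h ↦ by simpa using h
  have hs := tsum_even_add_odd (f := fun d ↦ oddMoebiusDiv d / d)
    (summable_oddMoebiusDiv_div.comp_injective heven)
    (summable_oddMoebiusDiv_div.comp_injective hodd)
  have hμ := tsum_even_add_odd
    (f := fun d : ℕ ↦ (ArithmeticFunction.moebius d : ℝ) / (d : ℝ) ^ 2)
    (summable_moebius_div_sq.comp_injective heven) (summable_moebius_div_sq.comp_injective hodd)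
  simp only [oddMoebiusDiv_two_mul, oddMoebiusDiv_two_mul_add_one, zero_div, tsum_zero, zero_add,
    div_div, ← sq] at hs
  rw [hs, tsum_moebius_div_sq] at hμ
  simp only [moebius_two_mul_div_sq, tsum_mul_left] at hμ
  linear_combination (4 / 3) * hμ

theorem hasMeanValue_totientWeight : HasMeanValue totientWeight (5 / Real.pi ^ 2) := by
  have hψ : HasMeanValue oddTotientRatio (8 / Real.pi ^ 2) :=
    tsum_oddMoebiusDiv_div ▸ hasMeanValue_mul_zeta summable_oddMoebiusDiv_div
  have h2 := hψ.ite_dvd two_pos oddTotientRatio_two_mul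
  have h4 := hψ.ite_dvd (k := 4) four_pos fun n ↦ by
    rw [show 4 * n = 2 * (2 * n) by ring, oddTotientRatio_two_mul, oddTotientRatio_two_mul]
  convert! (hψ.add (h2.const_smul (-1))).add (h4.const_smul (1 / 2)) using 1
  · exact funext totientWeight_eq
  · simp only [smul_eq_mul]
    push_cast
    ring

section WeightedMean

variable {𝕜 : Type*} [RCLike 𝕜] {h : ℕ → 𝕜} {κ : 𝕜} {f f' : ℝ → 𝕜} {a b : ℝ}

theorem inv_smul_sum_comp_div_mul_eq (ha : 0 ≤ a) (hab : a ≤ b)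
    (hf : ∀ x ∈ Set.Icc a b, HasDerivAt f (f' x) x) (hf' : ContinuousOn f' (Set.Icc a b))
    (h : ℕ → 𝕜) {X : ℝ} (hX : 0 < X) :
    X⁻¹ • ∑ k ∈ Finset.Ioc ⌊a * X⌋₊ ⌊b * X⌋₊, f (k / X) * h k =
      f b * X⁻¹ • ∑ k ∈ Finset.Icc 0 ⌊b * X⌋₊, h k -
        f a * X⁻¹ • ∑ k ∈ Finset.Icc 0 ⌊a * X⌋₊, h k -
          ∫ u in a..b, f' u * X⁻¹ • ∑ k ∈ Finset.Icc 0 ⌊u * X⌋₊, h k := by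
  have hle : a * X ≤ b * X := by gcongr
  have hmem : Set.MapsTo (· / X) (Set.Icc (a * X) (b * X)) (Set.Icc a b) := fun t ht ↦
    ⟨(le_div_iff₀ hX).2 ht.1, (div_le_iff₀ hX).2 ht.2⟩
  have hderiv : ∀ t ∈ Set.Icc (a * X) (b * X),
      HasDerivAt (fun t ↦ f (t / X)) (X⁻¹ • f' (t / X)) t := fun t ht ↦ by
    simpa only [one_div] using! (hf _ (hmem ht)).scomp t ((hasDerivAt_id t).div_const X)
  have hcont : ContinuousOn (fun t ↦ X⁻¹ • f' (t / X)) (Set.Icc (a * X) (b * X)) :=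
    (hf'.comp (by fun_prop) hmem).const_smul X⁻¹
  have hint : IntegrableOn (deriv fun t ↦ f (t / X)) (Set.Icc (a * X) (b * X)) :=
    hcont.integrableOn_Icc.congr_fun (fun t ht ↦ (hderiv t ht).deriv.symm) measurableSet_Icc
  have hscale : ∫ t in Set.Ioc (a * X) (b * X), deriv (fun t ↦ f (t / X)) t *
      ∑ k ∈ Finset.Icc 0 ⌊t⌋₊, h k =
        X • ∫ u in a..b, f' u * X⁻¹ • ∑ k ∈ Finset.Icc 0 ⌊u * X⌋₊, h k := by
    have hsub := intervalIntegral.integral_comp_div (a := a * X) (b := b * X)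
      (fun u ↦ f' u * X⁻¹ • ∑ k ∈ Finset.Icc 0 ⌊u * X⌋₊, h k) hX.ne'
    rw [mul_div_cancel_right₀ _ hX.ne', mul_div_cancel_right₀ _ hX.ne'] at hsub
    rw [← hsub, intervalIntegral.integral_of_le hle]
    refine setIntegral_congr_fun measurableSet_Ioc fun t ht ↦ ?_
    simp only [(hderiv t ⟨ht.1.le, ht.2⟩).deriv, div_mul_cancel₀ t hX.ne', smul_mul_assoc,
      mul_smul_comm]
  rw [sum_mul_eq_sub_sub_integral_mul h (f := fun t ↦ f (t / X)) (mul_nonneg ha hX.le) hle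
    (fun t ht ↦ (hderiv t ht).differentiableAt) hint, hscale]
  simp only [mul_div_cancel_right₀ _ hX.ne', smul_sub, mul_smul_comm, inv_smul_smul₀ hX.ne']

theorem HasMeanValue.tendsto_inv_smul_sum_comp_mul (hκ : HasMeanValue h κ) {u : ℝ} (hu : 0 < u) :
    Tendsto (fun X : ℝ ↦ X⁻¹ • ∑ k ∈ Finset.Icc 0 ⌊u * X⌋₊, h k) atTop (𝓝 (u • κ)) := by
  refine ((hκ.comp (tendsto_id.const_mul_atTop hu)).const_smul u).congr fun X ↦ ?_
  simp only [Function.comp_apply, id_eq, smul_smul]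
  congr 1
  field_simp

theorem HasMeanValue.eventually_norm_le (hκ : HasMeanValue h κ) (ha : 0 < a) (b : ℝ) :
    ∀ᶠ X : ℝ in atTop, ∀ u ∈ Set.Ioc a b,
      ‖X⁻¹ • ∑ k ∈ Finset.Icc 0 ⌊u * X⌋₊, h k‖ ≤ b * (‖κ‖ + 1) := by
  obtain ⟨x₀, hx₀⟩ := eventually_atTop.1 (hκ.norm.eventually_le_const (lt_add_one ‖κ‖))
  filter_upwards [eventually_gt_atTop 0, eventually_ge_atTop (x₀ / a)] with X hX hXa u hu
  have hu0 : 0 < u := ha.trans hu.1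
  have hux : x₀ ≤ u * X := by
    rw [div_le_iff₀' ha] at hXa
    exact hXa.trans (by gcongr; exact hu.1.le)
  have hXu : X⁻¹ = u * (u * X)⁻¹ := by field_simp
  rw [hXu, mul_smul, norm_smul, Real.norm_of_nonneg hu0.le]
  exact mul_le_mul hu.2 (hx₀ _ hux) (norm_nonneg _) (hu0.le.trans hu.2)

theorem HasMeanValue.tendsto_integral_mul (hκ : HasMeanValue h κ) (ha : 0 < a) (hab : a ≤ b)
    (hf' : ContinuousOn f' (Set.Icc a b)) :
    Tendsto (fun X : ℝ ↦ ∫ u in a..b, f' u * X⁻¹ • ∑ k ∈ Finset.Icc 0 ⌊u * X⌋₊, h k) atTop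
      (𝓝 (∫ u in a..b, f' u * u • κ)) := by
  have hmeas : Measurable fun x : ℝ ↦ ∑ k ∈ Finset.Icc 0 ⌊x⌋₊, h k :=
    (measurable_from_nat (f := fun n ↦ ∑ k ∈ Finset.Icc 0 n, h k)).comp Nat.measurable_floor
  refine intervalIntegral.tendsto_integral_filter_of_dominated_convergence
    (fun u ↦ ‖f' u‖ * (b * (‖κ‖ + 1))) ?_ ?_ ?_ ?_
  · refine Eventually.of_forall fun X ↦ ?_
    rw [Set.uIoc_of_le hab]
    exact ((hf'.mono Set.Ioc_subset_Icc_self).aestronglyMeasurable measurableSet_Ioc).mul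
      ((hmeas.comp (measurable_mul_const X)).const_smul X⁻¹).aestronglyMeasurable
  · filter_upwards [hκ.eventually_norm_le ha b] with X hX
    refine Eventually.of_forall fun u hu ↦ ?_
    rw [Set.uIoc_of_le hab] at hu
    rw [norm_mul]
    gcongr
    exact hX u hu
  · refine ContinuousOn.intervalIntegrable ?_
    rw [Set.uIcc_of_le hab]
    exact hf'.norm.mul continuousOn_const
  · refine Eventually.of_forall fun u hu ↦ ?_
    rw [Set.uIoc_of_le hab] at hu
    exact (hκ.tendsto_inv_smul_sum_comp_mul (ha.trans hu.1)).const_mul _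

theorem HasMeanValue.tendsto_weighted_sum (hκ : HasMeanValue h κ) (ha : 0 < a) (hab : a ≤ b)
    (hf : ∀ x ∈ Set.Icc a b, HasDerivAt f (f' x) x) (hf' : ContinuousOn f' (Set.Icc a b)) :
    Tendsto (fun X : ℝ ↦ X⁻¹ • ∑ k ∈ Finset.Ioc ⌊a * X⌋₊ ⌊b * X⌋₊, f (k / X) * h k) atTop
      (𝓝 (κ * ∫ x in a..b, f x)) := by
  have hparts : κ * ∫ x in a..b, f x =
      f b * b • κ - f a * a • κ - ∫ u in a..b, f' u * u • κ := by
    have hint := intervalIntegral.integral_mul_deriv_eq_deriv_mul (u := f) (u' := f')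
      (v := fun x ↦ x • κ) (v' := fun _ ↦ κ) (a := a) (b := b)
      (fun x hx ↦ hf x (by rwa [Set.uIcc_of_le hab] at hx))
      (fun x _ ↦ by simpa using (hasDerivAt_id x).smul_const κ)
      (ContinuousOn.intervalIntegrable (by rwa [Set.uIcc_of_le hab])) (by simp)
    rw [← hint, intervalIntegral.integral_mul_const, mul_comm]
  rw [hparts]
  refine Tendsto.congr' ?_ ((((hκ.tendsto_inv_smul_sum_comp_mul (ha.trans_le hab)).const_mul
    (f b)).sub ((hκ.tendsto_inv_smul_sum_comp_mul ha).const_mul (f a))).sub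
      (hκ.tendsto_integral_mul ha hab hf'))
  filter_upwards [eventually_gt_atTop 0] with X hX
  exact (inv_smul_sum_comp_div_mul_eq ha.le hab hf hf' h hX).symm

end WeightedMean

/-! ### Gauss sums -/

theorem sum_nthRootsFinset_one {R : Type*} [CommRing R] [IsDomain R] {ζ : R} {n : ℕ}
    (hζ : IsPrimitiveRoot ζ n) :
    ∑ ξ ∈ Polynomial.nthRootsFinset n (1 : R), ξ = if n = 1 then 1 else 0 := by
  classical
  have hsum : ∑ ξ ∈ Polynomial.nthRootsFinset n (1 : R), ξ = ∑ i ∈ Finset.range n, ζ ^ i := by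
    rw [Polynomial.nthRootsFinset, ← Multiset.toFinset_eq hζ.nthRoots_one_nodup, Finset.sum_mk,
      hζ.nthRoots_eq (one_pow n), Multiset.map_map]
    simp only [mul_one, Function.comp_apply]
    rfl
  rcases n with _ | _ | n
  · simp
  · simp [hsum]
  · rw [hsum, hζ.geom_sum_eq_zero (by omega), if_neg (by omega)]

theorem sum_primitiveRoots_complex {n : ℕ} (hn : n ≠ 0) :
    ∑ ξ ∈ primitiveRoots n ℂ, ξ = (ArithmeticFunction.moebius n : ℂ) := by
  classical
  have hdiv : ∀ m > 0, ∑ d ∈ m.divisors, ∑ ξ ∈ primitiveRoots d ℂ, ξ =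
      if m = 1 then (1 : ℂ) else 0 := fun m hm ↦ by
    rw [← sum_nthRootsFinset_one (Complex.isPrimitiveRoot_exp m hm.ne'),
      IsPrimitiveRoot.nthRoots_one_eq_biUnion_primitiveRoots,
      Finset.sum_biUnion fun i _ j _ hij ↦ IsPrimitiveRoot.disjoint hij]
  rw [← ArithmeticFunction.sum_eq_iff_sum_mul_moebius_eq.1 hdiv n (Nat.pos_of_ne_zero hn),
    Finset.sum_eq_single (n, 1)]
  · simp
  · rintro ⟨d, e⟩ hde hne
    have he : e ≠ 1 := fun he ↦ hne (by simp_all)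
    simp [he]
  · simp [hn]

theorem gaussSum_one_stdAddChar (N : ℕ) [NeZero N] :
    gaussSum (1 : DirichletCharacter ℂ N) stdAddChar = (ArithmeticFunction.moebius N : ℂ) := by
  classical
  have hroot (i : ℕ) : (stdAddChar (i : ZMod N) : ℂ) =
      Complex.exp (2 * Real.pi * Complex.I * (i / N)) := by
    rw [ZMod.stdAddChar_apply, ZMod.toCircle_natCast, mul_div_assoc]
  calc gaussSum (1 : DirichletCharacter ℂ N) stdAddChar
    _ = ∑ a : ZMod N with IsUnit a, stdAddChar a := by
      rw [gaussSum, Finset.sum_filter]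
      refine Finset.sum_congr rfl fun a _ ↦ ?_
      split_ifs with ha
      · rw [MulChar.one_apply ha, one_mul]
      · rw [MulChar.map_nonunit _ ha, zero_mul]
    _ = ∑ ξ ∈ primitiveRoots N ℂ, ξ := by
      refine Finset.sum_nbij (fun a ↦ stdAddChar a) (fun a ha ↦ ?_)
        ZMod.injective_stdAddChar.injOn (fun ξ hξ ↦ ?_) fun _ _ ↦ rfl
      · rw [← ZMod.natCast_zmod_val a, Finset.mem_filter_univ, ZMod.isUnit_iff_coprime] at ha
        rw [← ZMod.natCast_zmod_val a, hroot, mem_primitiveRoots (NeZero.pos N)]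
        exact Complex.isPrimitiveRoot_exp_of_coprime _ _ (NeZero.ne N) ha
      · obtain ⟨i, -, hi, rfl⟩ := (Complex.isPrimitiveRoot_iff ξ N (NeZero.ne N)).1
          (isPrimitiveRoot_of_mem_primitiveRoots hξ)
        refine ⟨i, ?_, hroot i⟩
        rwa [Finset.mem_coe, Finset.mem_filter_univ, ZMod.isUnit_iff_coprime]
    _ = ArithmeticFunction.moebius N := sum_primitiveRoots_complex (NeZero.ne N)

theorem gaussSum_mul_gaussSum_inv {N : ℕ} [NeZero N] {χ : DirichletCharacter ℂ N}
    (hχ : χ.IsPrimitive) :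
    gaussSum χ stdAddChar * gaussSum χ⁻¹ stdAddChar = χ (-1) * N := by
  have hfourier : ZMod.dft χ = fun k ↦ gaussSum χ stdAddChar * χ⁻¹ (-k) :=
    funext fun k ↦ by rw [hχ.fourierTransform_eq_inv_mul_gaussSum, mul_comm]
  have hinv := congr_fun (ZMod.dft_dft χ) 1
  rw [hfourier, ZMod.dft_const_mul, ZMod.dft_comp_neg] at hinv
  simpa [DirichletCharacter.fourierTransform_eq_gaussSum_mulShift, mul_comm] using hinv

theorem sum_gaussSum_inv_mul {N : ℕ} [NeZero N] {a : ZMod N} (ha : IsUnit a) :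
    ∑ χ : DirichletCharacter ℂ N, gaussSum χ⁻¹ stdAddChar * χ a = N.totient * stdAddChar a := by
  have hinv (χ : DirichletCharacter ℂ N) : χ⁻¹ a = χ a⁻¹ := by
    obtain ⟨u, rfl⟩ := ha
    rw [MulChar.inv_apply, Ring.inverse_unit, ZMod.inv_coe_unit]
  calc ∑ χ : DirichletCharacter ℂ N, gaussSum χ⁻¹ stdAddChar * χ a
    _ = ∑ χ : DirichletCharacter ℂ N, ∑ b, stdAddChar b * (χ a⁻¹ * χ b) := by
      rw [← Equiv.sum_comp (Equiv.inv (DirichletCharacter ℂ N))]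
      refine Finset.sum_congr rfl fun χ _ ↦ ?_
      rw [Equiv.inv_apply, inv_inv, hinv, gaussSum, Finset.sum_mul]
      exact Finset.sum_congr rfl fun b _ ↦ by ring
    _ = ∑ b, stdAddChar b * if a = b then (N.totient : ℂ) else 0 := by
      rw [Finset.sum_comm]
      simp only [← Finset.mul_sum, DirichletCharacter.sum_char_inv_mul_char_eq ℂ ha]
    _ = N.totient * stdAddChar a := by simp [mul_comm]

theorem intCast_units_mul_self (ε : ℤˣ) : ((ε : ℤ) : ℂ) * ((ε : ℤ) : ℂ) = 1 := by
  rcases Int.units_eq_one_or ε with rfl | rfl <;> simp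

/-- The wave `cos` for `ε = 1` and `-i sin` for `ε = -1`. -/
noncomputable def parityWave (ε : ℤˣ) (x : ℝ) : ℂ :=
  (((ε : ℤ) : ℂ) * Complex.exp (x * Complex.I) + Complex.exp (-(x * Complex.I))) / 2

theorem parityWave_one (x : ℝ) : parityWave 1 x = (Real.cos x : ℂ) := by
  rw [parityWave, Complex.ofReal_cos, Complex.cos, neg_mul]
  simp

theorem parityWave_neg_one (x : ℝ) : parityWave (-1) x = -Complex.I * (Real.sin x : ℂ) := by
  rw [parityWave, Complex.ofReal_sin, Complex.sin, neg_mul (x : ℂ)]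
  push_cast [Units.val_neg, Units.val_one]
  linear_combination (Complex.exp (x * Complex.I) - Complex.exp (-(x * Complex.I))) / 2 *
    -Complex.I_sq

theorem norm_parityWave_le_one (ε : ℤˣ) (x : ℝ) : ‖parityWave ε x‖ ≤ 1 := by
  rcases Int.units_eq_one_or ε with rfl | rfl
  · rw [parityWave_one, Complex.norm_real]
    exact Real.abs_cos_le_one x
  · rw [parityWave_neg_one, norm_mul, norm_neg, Complex.norm_I, one_mul, Complex.norm_real]
    exact Real.abs_sin_le_one x

theorem hasDerivAt_parityWave (ε : ℤˣ) (x : ℝ) :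
    HasDerivAt (parityWave ε) (-Complex.I * parityWave (-ε) x) x := by
  have hexp := ((Complex.ofRealCLM.hasDerivAt (x := x)).mul_const Complex.I).cexp
  have hexp' := ((Complex.ofRealCLM.hasDerivAt (x := x)).mul_const Complex.I).fun_neg.cexp
  refine (((hexp.const_mul ((ε : ℤ) : ℂ)).add hexp').div_const 2).congr_deriv ?_
  simp only [parityWave, Complex.ofRealCLM_apply, Units.val_neg, Int.cast_neg, Complex.ofReal_one]
  ring

theorem continuous_parityWave (ε : ℤˣ) : Continuous (parityWave ε) :=
  continuous_iff_continuousAt.2 fun x ↦ (hasDerivAt_parityWave ε x).continuousAt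

theorem norm_parityWave_sub_le (ε : ℤˣ) (x y : ℝ) :
    ‖parityWave ε x - parityWave ε y‖ ≤ |x - y| := by
  have hbound (z : ℝ) : ‖-Complex.I * parityWave (-ε) z‖ ≤ 1 := by
    rw [norm_mul, norm_neg, Complex.norm_I, one_mul]
    exact norm_parityWave_le_one (-ε) z
  simpa using convex_univ.norm_image_sub_le_of_norm_hasDerivWithin_le
    (fun z _ ↦ (hasDerivAt_parityWave ε z).hasDerivWithinAt) (fun z _ ↦ hbound z)
    (Set.mem_univ y) (Set.mem_univ x)

open Classical in
theorem sum_parity_gaussSum_inv_mul {N : ℕ} [NeZero N] (ε : ℤˣ) {a : ZMod N} (ha : IsUnit a) :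
    ∑ χ : DirichletCharacter ℂ N with χ (-1) = ((ε : ℤ) : ℂ), gaussSum χ⁻¹ stdAddChar * χ a =
      N.totient * ((stdAddChar a + ((ε : ℤ) : ℂ) * stdAddChar (-a)) / 2) := by
  have hproj (χ : DirichletCharacter ℂ N) :
      (if χ (-1) = ((ε : ℤ) : ℂ) then gaussSum χ⁻¹ stdAddChar * χ a else 0) =
        (gaussSum χ⁻¹ stdAddChar * χ a +
          ((ε : ℤ) : ℂ) * (gaussSum χ⁻¹ stdAddChar * χ (-a))) / 2 := by
    rw [← neg_one_mul a, map_mul]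
    rcases χ.even_or_odd with hχ | hχ <;> rcases Int.units_eq_one_or ε with rfl | rfl <;>
      rw [hχ] <;> norm_num
  rw [Finset.sum_filter, Finset.sum_congr rfl fun χ _ ↦ hproj χ, ← Finset.sum_div,
    Finset.sum_add_distrib, ← Finset.mul_sum, sum_gaussSum_inv_mul ha, sum_gaussSum_inv_mul ha.neg]
  ring

/-- The contribution of the modulus `N` to `X * T ε y X c`, where `p` is `⌈yX⌉^𝔭`. -/
noncomputable def modulusTerm (ε : ℤˣ) (p N : ℕ) : ℂ :=
  ∑ χ ∈ primitiveChars ε N, χ (p : ZMod N) / tau χ +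
    ((ε : ℤ) : ℂ) * (1 / (N : ℂ) * ∑ χ ∈ imprimitiveChars ε N, tau (star χ) * χ (p : ZMod N))

theorem T_eq_sum_modulusTerm (ε : ℤˣ) (y X c : ℝ) :
    T ε y X c = 1 / (X : ℂ) * ∑ N ∈ conductors X c, modulusTerm ε (primeCeil (y * X)) N := by
  simp only [T, Q, E, modulusTerm, Finset.sum_add_distrib, ← Finset.mul_sum]
  ring

theorem div_tau_eq_of_mem_primitiveChars {N : ℕ} [NeZero N] {ε : ℤˣ} {χ : DirichletCharacter ℂ N}
    (hχ : χ ∈ primitiveChars ε N) (a : ZMod N) :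
    χ a / tau χ = ((ε : ℤ) : ℂ) / N * (gaussSum χ⁻¹ stdAddChar * χ a) := by
  obtain ⟨hprim, hparity⟩ : χ.IsPrimitive ∧ χ (-1) = ((ε : ℤ) : ℂ) := by
    simpa only [primitiveChars, Finset.mem_filter, Finset.mem_univ, true_and] using hχ
  have hdual := gaussSum_mul_gaussSum_inv hprim
  rw [hparity] at hdual
  have hN : (N : ℂ) ≠ 0 := NeZero.ne _
  have hεε := intCast_units_mul_self ε
  have hτ : gaussSum χ stdAddChar ≠ 0 :=
    left_ne_zero_of_mul (hdual ▸ mul_ne_zero (left_ne_zero_of_mul_eq_one hεε) hN)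
  rw [tau_eq_gaussSum, div_eq_iff hτ]
  field_simp
  linear_combination -χ a * N * hεε - χ a * ((ε : ℤ) : ℂ) * hdual

open Classical in
theorem norm_modulusTerm_sub_sum_le {N : ℕ} [NeZero N] (ε : ℤˣ) (p : ℕ) :
    ‖modulusTerm ε p N - ((ε : ℤ) : ℂ) / N *
      ∑ χ : DirichletCharacter ℂ N with χ (-1) = ((ε : ℤ) : ℂ),
        gaussSum χ⁻¹ stdAddChar * χ (p : ZMod N)‖ ≤ 1 / N := by
  set F : DirichletCharacter ℂ N → ℂ := fun χ ↦ gaussSum χ⁻¹ stdAddChar * χ (p : ZMod N)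
  have hterm : modulusTerm ε p N = ((ε : ℤ) : ℂ) / N *
      (∑ χ ∈ primitiveChars ε N, F χ + ∑ χ ∈ imprimitiveChars ε N, F χ) := by
    rw [modulusTerm, Finset.sum_congr rfl fun χ hχ ↦ div_tau_eq_of_mem_primitiveChars hχ _,
      ← Finset.mul_sum]
    simp only [tau_eq_gaussSum, MulChar.star_eq_inv, F]
    ring
  have hprincipal : (∑ χ ∈ primitiveChars ε N, F χ + ∑ χ ∈ imprimitiveChars ε N, F χ) -
      ∑ χ : DirichletCharacter ℂ N with χ (-1) = ((ε : ℤ) : ℂ), F χ =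
      -(if (1 : DirichletCharacter ℂ N) (-1) = ((ε : ℤ) : ℂ) ∧
        ¬ (1 : DirichletCharacter ℂ N).IsPrimitive then F 1 else 0) := by
    simp only [primitiveChars, imprimitiveChars, Finset.sum_filter]
    rw [← Finset.sum_add_distrib, ← Finset.sum_sub_distrib,
      Finset.sum_eq_single_of_mem 1 (Finset.mem_univ _)]
    · split_ifs <;> simp_all
    · intro χ _ hχ
      split_ifs <;> simp_all
  have hF : ‖F 1‖ ≤ 1 := by
    simp only [F, inv_one, gaussSum_one_stdAddChar, norm_mul, Complex.norm_intCast]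
    exact mul_le_one₀ (by exact_mod_cast ArithmeticFunction.abs_moebius_le_one) (norm_nonneg _)
      (DirichletCharacter.norm_le_one _ _)
  have hε : ‖((ε : ℤ) : ℂ)‖ = 1 := by rcases Int.units_eq_one_or ε with rfl | rfl <;> simp
  rw [hterm, ← mul_sub, hprincipal, norm_mul, norm_div, hε, norm_neg, Complex.norm_natCast]
  refine mul_le_of_le_one_right (by positivity) ?_
  split_ifs
  · exact hF
  · simp

theorem mul_sum_stdAddChar_eq_parityWave {N : ℕ} [NeZero N] (ε : ℤˣ) (p : ℕ) :
    ((ε : ℤ) : ℂ) * ((stdAddChar (p : ZMod N) + ((ε : ℤ) : ℂ) * stdAddChar (-(p : ZMod N))) / 2) =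
      parityWave ε (2 * Real.pi * p / N) := by
  have hεε := intCast_units_mul_self ε
  have hexp : (stdAddChar (p : ZMod N) : ℂ) =
      Complex.exp ((2 * Real.pi * p / N : ℝ) * Complex.I) := by
    rw [ZMod.stdAddChar_apply, ZMod.toCircle_natCast]
    congr 1
    push_cast
    ring
  rw [AddChar.map_neg_eq_inv, hexp, ← Complex.exp_neg, parityWave]
  linear_combination Complex.exp (-((2 * Real.pi * p / N : ℝ) * Complex.I)) / 2 * hεε

theorem norm_totient_div_le_one (N : ℕ) : ‖((N.totient / N : ℝ) : ℂ)‖ ≤ 1 := by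
  rw [Complex.norm_real, Real.norm_of_nonneg (by positivity)]
  exact div_le_one_of_le₀ (mod_cast N.totient_le) N.cast_nonneg

theorem norm_modulusTerm_sub_le (ε : ℤˣ) {p N : ℕ} (hp : p.Prime) (hN : N ≠ 0) :
    ‖modulusTerm ε p N - (N.totient / N : ℝ) * parityWave ε (2 * Real.pi * p / N)‖ ≤
      1 / N + if p ∣ N then 1 else 0 := by
  have : NeZero N := ⟨hN⟩
  split_ifs with hdvd
  · have hnonunit : ¬ IsUnit (p : ZMod N) := by
      rwa [ZMod.isUnit_prime_iff_not_dvd hp, not_not]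
    have hzero : modulusTerm ε p N = 0 := by
      simp [modulusTerm, MulChar.map_nonunit _ hnonunit]
    rw [hzero, zero_sub, norm_neg, norm_mul]
    refine (mul_le_one₀ (norm_totient_div_le_one N) (norm_nonneg _)
      (norm_parityWave_le_one _ _)).trans ?_
    exact le_add_of_nonneg_left (by positivity)
  · have hmain := sum_parity_gaussSum_inv_mul ε (ZMod.isUnit_prime_of_not_dvd hp hdvd)
    have hwave : (N.totient / N : ℝ) * parityWave ε (2 * Real.pi * p / N) = ((ε : ℤ) : ℂ) / N *
        ∑ χ : DirichletCharacter ℂ N with χ (-1) = ((ε : ℤ) : ℂ),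
          gaussSum χ⁻¹ stdAddChar * χ (p : ZMod N) := by
      rw [hmain, ← mul_sum_stdAddChar_eq_parityWave]
      push_cast
      ring
    rw [hwave, add_zero]
    exact norm_modulusTerm_sub_sum_le ε p

/-! ### The limit -/

theorem card_conductors_le {X c : ℝ} (hX : 0 < X) (hc : 0 ≤ c) :
    ((conductors X c).card : ℝ) ≤ c * X := by
  have hceil : 1 ≤ ⌈X⌉₊ := Nat.one_le_ceil_iff.mpr hX
  calc ((conductors X c).card : ℝ)
    _ ≤ ((Finset.Icc ⌈X⌉₊ ⌊c * X⌋₊).card : ℝ) := Nat.cast_le.mpr (Finset.card_filter_le _ _)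
    _ ≤ (⌊c * X⌋₊ : ℝ) := by
      rw [Nat.card_Icc]
      exact_mod_cast (by omega : ⌊c * X⌋₊ + 1 - ⌈X⌉₊ ≤ ⌊c * X⌋₊)
    _ ≤ c * X := Nat.floor_le (by positivity)

theorem le_of_mem_conductors {X c : ℝ} {N : ℕ} (hN : N ∈ conductors X c) : X ≤ N :=
  Nat.ceil_le.1 (Finset.mem_Icc.1 (Finset.mem_filter.1 hN).1).1

theorem sum_conductors_ite_dvd_le {X c : ℝ} (hX : 0 < X) (hc : 0 ≤ c) (p : ℕ) :
    ∑ N ∈ conductors X c, (if p ∣ N then (1 : ℝ) else 0) ≤ c * X / p := by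
  have hsub : (conductors X c).filter (p ∣ ·) ⊆ (Finset.Ioc 0 ⌊c * X⌋₊).filter (p ∣ ·) :=
    Finset.filter_subset_filter _ fun N hN ↦ Finset.mem_Ioc.2
      ⟨Nat.cast_pos.1 (hX.trans_le (le_of_mem_conductors hN)),
        (Finset.mem_Icc.1 (Finset.mem_filter.1 hN).1).2⟩
  rw [Finset.sum_boole]
  calc (((conductors X c).filter (p ∣ ·)).card : ℝ)
    _ ≤ (⌊c * X⌋₊ / p : ℕ) := by
      rw [← Nat.Ioc_filter_dvd_card_eq_div]
      exact_mod_cast Finset.card_le_card hsub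
    _ ≤ (⌊c * X⌋₊ : ℝ) / p := Nat.cast_div_le
    _ ≤ c * X / p := by
      gcongr
      exact Nat.floor_le (by positivity)

theorem norm_T_sub_sum_parityWave_le (ε : ℤˣ) {X c y : ℝ} (hX : 0 < X) (hc : 0 ≤ c) (hy : 0 < y) :
    ‖T ε y X c - X⁻¹ • ∑ N ∈ conductors X c,
      (N.totient / N : ℝ) * parityWave ε (2 * Real.pi * primeCeil (y * X) / N)‖ ≤
      (c + c / y) / X := by
  set p := primeCeil (y * X)
  obtain ⟨hprime, hyX⟩ : p.Prime ∧ y * X ≤ p := primeCeil_spec (y * X)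
  have hdvd : ∑ N ∈ conductors X c, (if p ∣ N then (1 : ℝ) else 0) ≤ c / y :=
    calc _ ≤ c * X / p := sum_conductors_ite_dvd_le hX hc p
      _ ≤ c * X / (y * X) := by gcongr
      _ = c / y := by field_simp
  have hterm (N : ℕ) (hN : N ∈ conductors X c) :
      ‖modulusTerm ε p N - (N.totient / N : ℝ) * parityWave ε (2 * Real.pi * p / N)‖ ≤
        1 / X + if p ∣ N then 1 else 0 := by
    have hXN := le_of_mem_conductors hN
    have hN0 : N ≠ 0 := (Nat.cast_pos.1 (hX.trans_le hXN)).ne'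
    refine (norm_modulusTerm_sub_le ε hprime hN0).trans ?_
    gcongr
  have hT : T ε y X c = X⁻¹ • ∑ N ∈ conductors X c, modulusTerm ε p N := by
    rw [T_eq_sum_modulusTerm, Complex.real_smul, one_div, Complex.ofReal_inv]
  rw [hT, ← smul_sub, ← Finset.sum_sub_distrib, norm_smul, norm_inv, Real.norm_of_nonneg hX.le,
    div_eq_inv_mul]
  gcongr
  calc _ ≤ ∑ N ∈ conductors X c, (1 / X + if p ∣ N then 1 else 0) := norm_sum_le_of_le _ hterm
    _ = (conductors X c).card * (1 / X) + ∑ N ∈ conductors X c, (if p ∣ N then 1 else 0) := by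
      rw [Finset.sum_add_distrib, Finset.sum_const, nsmul_eq_mul]
    _ ≤ c * X * (1 / X) + c / y := by
      gcongr
      exact card_conductors_le hX hc
    _ = c + c / y := by field_simp

theorem sum_conductors_totient_div_mul (X c : ℝ) (f : ℕ → ℂ) :
    ∑ N ∈ conductors X c, (N.totient / N : ℝ) * f N =
      ∑ N ∈ Finset.Icc ⌈X⌉₊ ⌊c * X⌋₊, f N * totientWeight N := by
  rw [conductors, Finset.sum_filter]
  refine Finset.sum_congr rfl fun N _ ↦ ?_
  rw [totientWeight]
  by_cases h : N ≡ 2 [MOD 4] <;> simp [h, mul_comm]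

theorem norm_parityWave_two_pi_div_sub_le (ε : ℤˣ) {X n : ℝ} (hX : 0 < X) (hn : X ≤ n) (p y : ℝ) :
    ‖parityWave ε (2 * Real.pi * p / n) - parityWave ε (2 * Real.pi * y / (n / X))‖ ≤
      2 * Real.pi * |p / X - y| := by
  have hn0 : 0 < n := hX.trans_le hn
  calc _ ≤ |2 * Real.pi * p / n - 2 * Real.pi * y / (n / X)| := norm_parityWave_sub_le ε _ _
    _ = |2 * Real.pi * (p / X - y) * (X / n)| := by
      congr 1
      field_simp
    _ = 2 * Real.pi * |p / X - y| * (X / n) := by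
      rw [abs_mul, abs_mul, abs_of_pos Real.two_pi_pos, abs_of_pos (div_pos hX hn0)]
    _ ≤ 2 * Real.pi * |p / X - y| :=
      mul_le_of_le_one_right (by positivity) ((div_le_one hn0).2 hn)

theorem norm_sum_Icc_ceil_sub_sum_Ioc_floor_le {G : Type*} [SeminormedAddCommGroup G] {f : ℕ → G}
    {B : ℝ} (hf : ∀ n, ‖f n‖ ≤ B) (x : ℝ) (m : ℕ) :
    ‖∑ n ∈ Finset.Icc ⌈x⌉₊ m, f n - ∑ n ∈ Finset.Ioc ⌊x⌋₊ m, f n‖ ≤ B := by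
  have hsub : Finset.Ioc ⌊x⌋₊ m ⊆ Finset.Icc ⌈x⌉₊ m := fun n hn ↦ by
    rw [Finset.mem_Ioc] at hn
    exact Finset.mem_Icc.2 ⟨(Nat.ceil_le_floor_add_one x).trans hn.1, hn.2⟩
  have hsdiff : Finset.Icc ⌈x⌉₊ m \ Finset.Ioc ⌊x⌋₊ m ⊆ {⌊x⌋₊} := fun n hn ↦ by
    rw [Finset.mem_sdiff, Finset.mem_Icc, Finset.mem_Ioc] at hn
    have hle : ⌊x⌋₊ ≤ ⌈x⌉₊ := Nat.floor_le_ceil x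
    rw [Finset.mem_singleton]
    omega
  rw [← Finset.sum_sdiff hsub, add_sub_cancel_right]
  calc _ ≤ ∑ n ∈ Finset.Icc ⌈x⌉₊ m \ Finset.Ioc ⌊x⌋₊ m, ‖f n‖ := norm_sum_le _ _
    _ ≤ ∑ n ∈ {⌊x⌋₊}, ‖f n‖ :=
      Finset.sum_le_sum_of_subset_of_nonneg hsdiff fun _ _ _ ↦ norm_nonneg _
    _ ≤ B := by simpa using hf ⌊x⌋₊

theorem tendsto_T_sub_sum_parityWave (ε : ℤˣ) {c y : ℝ} (hc : 0 ≤ c) (hy : 0 < y) :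
    Tendsto (fun X : ℝ ↦ T ε y X c - X⁻¹ • ∑ N ∈ conductors X c,
      (N.totient / N : ℝ) * parityWave ε (2 * Real.pi * y / (N / X))) atTop (𝓝 0) := by
  have hprime : Tendsto (fun X : ℝ ↦ T ε y X c - X⁻¹ • ∑ N ∈ conductors X c,
      (N.totient / N : ℝ) * parityWave ε (2 * Real.pi * primeCeil (y * X) / N)) atTop (𝓝 0) := by
    refine squeeze_zero_norm' ?_ (tendsto_id.const_div_atTop (c + c / y))
    filter_upwards [eventually_gt_atTop 0] with X hX
    exact norm_T_sub_sum_parityWave_le ε hX hc hy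
  have hshift : Tendsto (fun X : ℝ ↦ c * (2 * Real.pi * |primeCeil (y * X) / X - y|))
      atTop (𝓝 0) := by
    simpa using
      (((tendsto_primeCeil_mul_div hy).sub_const y).abs.const_mul (2 * Real.pi)).const_mul c
  have hreplace : Tendsto (fun X : ℝ ↦ X⁻¹ • ∑ N ∈ conductors X c,
      (N.totient / N : ℝ) * (parityWave ε (2 * Real.pi * primeCeil (y * X) / N) -
        parityWave ε (2 * Real.pi * y / (N / X)))) atTop (𝓝 0) := by
    refine squeeze_zero_norm' ?_ hshift
    filter_upwards [eventually_gt_atTop 0] with X hX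
    rw [norm_smul, norm_inv, Real.norm_of_nonneg hX.le, inv_mul_le_iff₀ hX]
    calc _ ≤ ∑ N ∈ conductors X c, 2 * Real.pi * |primeCeil (y * X) / X - y| := by
          refine norm_sum_le_of_le _ fun N hN ↦ ?_
          rw [norm_mul]
          exact (mul_le_of_le_one_left (norm_nonneg _) (norm_totient_div_le_one N)).trans
            (norm_parityWave_two_pi_div_sub_le ε hX (le_of_mem_conductors hN) _ y)
      _ = (conductors X c).card * (2 * Real.pi * |primeCeil (y * X) / X - y|) := by
          rw [Finset.sum_const, nsmul_eq_mul]
      _ ≤ c * X * (2 * Real.pi * |primeCeil (y * X) / X - y|) := by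
          gcongr
          exact card_conductors_le hX hc
      _ = X * (c * (2 * Real.pi * |primeCeil (y * X) / X - y|)) := by ring
  convert! hprime.add hreplace using 2 with X
  · simp only [mul_sub, Finset.sum_sub_distrib, smul_sub, sub_add_sub_cancel]
  · rw [add_zero]

theorem norm_totientWeight_le_one (n : ℕ) : ‖(totientWeight n : ℂ)‖ ≤ 1 := by
  rw [totientWeight]
  split_ifs
  · simp
  · exact norm_totient_div_le_one n

theorem tendsto_sum_conductors_comp_div {f f' : ℝ → ℂ} {c B : ℝ} (hc : 1 ≤ c)
    (hf : ∀ x ∈ Set.Icc 1 c, HasDerivAt f (f' x) x) (hf' : ContinuousOn f' (Set.Icc 1 c))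
    (hB : ∀ x, ‖f x‖ ≤ B) :
    Tendsto (fun X : ℝ ↦ X⁻¹ • ∑ N ∈ conductors X c, (N.totient / N : ℝ) * f (N / X)) atTop
      (𝓝 ((5 / Real.pi ^ 2 : ℝ) * ∫ x in (1 : ℝ)..c, f x)) := by
  have hmean : HasMeanValue (fun n ↦ (totientWeight n : ℂ)) ((5 / Real.pi ^ 2 : ℝ) : ℂ) :=
    hasMeanValue_totientWeight.map Complex.ofRealCLM
  have hIoc := hmean.tendsto_weighted_sum one_pos hc hf hf'
  have hterm (X : ℝ) (n : ℕ) : ‖f (n / X) * totientWeight n‖ ≤ B := by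
    rw [norm_mul]
    exact (mul_le_of_le_one_right (norm_nonneg _) (norm_totientWeight_le_one n)).trans (hB _)
  have hendpoint : Tendsto (fun X : ℝ ↦
      X⁻¹ • (∑ N ∈ Finset.Icc ⌈X⌉₊ ⌊c * X⌋₊, f (N / X) * totientWeight N -
        ∑ N ∈ Finset.Ioc ⌊X⌋₊ ⌊c * X⌋₊, f (N / X) * totientWeight N)) atTop (𝓝 0) := by
    refine squeeze_zero_norm' ?_ (tendsto_id.const_div_atTop B)
    filter_upwards [eventually_gt_atTop 0] with X hX
    rw [norm_smul, norm_inv, Real.norm_of_nonneg hX.le, ← div_eq_inv_mul]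
    exact div_le_div_of_nonneg_right
      (norm_sum_Icc_ceil_sub_sum_Ioc_floor_le (hterm X) X _) hX.le
  simp only [one_mul] at hIoc
  simpa only [sum_conductors_totient_div_mul, smul_sub, sub_add_cancel, zero_add]
    using hendpoint.add hIoc

theorem tendsto_T (ε : ℤˣ) {c y : ℝ} (hc : 1 ≤ c) (hy : 0 < y) :
    Tendsto (fun X : ℝ ↦ T ε y X c) atTop
      (𝓝 ((5 / Real.pi ^ 2 : ℝ) * ∫ x in (1 : ℝ)..c, parityWave ε (2 * Real.pi * y / x))) := by
  have hne (x : ℝ) (hx : x ∈ Set.Icc 1 c) : x ≠ 0 := (one_pos.trans_le hx.1).ne'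
  have hderiv (x : ℝ) (hx : x ∈ Set.Icc 1 c) :
      HasDerivAt (fun x ↦ parityWave ε (2 * Real.pi * y / x))
        ((-(2 * Real.pi * y) / x ^ 2) • (-Complex.I * parityWave (-ε) (2 * Real.pi * y / x)))
        x := by
    have hdiv : HasDerivAt (fun x : ℝ ↦ 2 * Real.pi * y / x) (-(2 * Real.pi * y) / x ^ 2) x :=
      ((hasDerivAt_const x (2 * Real.pi * y)).div (hasDerivAt_id x) (hne x hx)).congr_deriv
        (by simp)
    exact (hasDerivAt_parityWave ε _).scomp x hdiv
  have hcont : ContinuousOn (fun x : ℝ ↦ (-(2 * Real.pi * y) / x ^ 2) •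
      (-Complex.I * parityWave (-ε) (2 * Real.pi * y / x))) (Set.Icc 1 c) := by
    refine (continuousOn_const.div (by fun_prop) fun x hx ↦ pow_ne_zero 2 (hne x hx)).smul
      (continuousOn_const.mul ((continuous_parityWave _).comp_continuousOn ?_))
    exact continuousOn_const.div continuousOn_id hne
  have hlimit := tendsto_sum_conductors_comp_div hc hderiv hcont fun x ↦ norm_parityWave_le_one ε _
  simpa only [sub_add_cancel, zero_add] using
    (tendsto_T_sub_sum_parityWave ε (zero_le_one.trans hc) hy).add hlimit

end Murmuration

theorem mainTheorem4 (c y : ℝ) (hc : 1 < c) (hy : 0 < y) :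
    Filter.Tendsto (fun X : ℝ => Murmuration.T 1 y X c) Filter.atTop
      (nhds (5 / (Real.pi : ℂ) ^ 2 *
        ((∫ x in (1 : ℝ)..c, Real.cos (2 * Real.pi * y / x) : ℝ) : ℂ))) ∧
    Filter.Tendsto (fun X : ℝ => Murmuration.T (-1) y X c) Filter.atTop
      (nhds (-Complex.I * (5 / (Real.pi : ℂ) ^ 2) *
        ((∫ x in (1 : ℝ)..c, Real.sin (2 * Real.pi * y / x) : ℝ) : ℂ))) := by
  constructor
  · convert! Murmuration.tendsto_T 1 hc.le hy using 2
    simp only [Murmuration.parityWave_one, intervalIntegral.integral_ofReal]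
    push_cast
    rfl
  · convert! Murmuration.tendsto_T (-1) hc.le hy using 2
    simp only [Murmuration.parityWave_neg_one, intervalIntegral.integral_const_mul,
      intervalIntegral.integral_ofReal]
    push_cast
    ring
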